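/- For a bit string $x\in\{0,1\}^n$ let $|x|$ be its Hamming weight and $|x\rangle\in(\mathbb C^2)^{\otimes n}$ the corresponding computational basis state. For $\pi\in S_n$ let $D(\pi)|x_1\cdots x_n\rangle=|x_{\pi^{-1}(1)}\cdots x_{\pi^{-1}(n)}\rangle$, and for a partition $\mu\vdash n$ let $\chi_\mu$ and $d_\mu$ be the character and the dimension of the irreducible representation of $S_n$ labelled by $\mu$, and $$P_\mu=\frac{d_\mu}{n!}\sum_{\pi\in S_n}\chi_\mu(\pi)\,D(\pi).$$ For every $n\ge 0$ the operators $(P_\mu)_{\mu\vdash n}$ form a projective measurement on $n$ qubits (weak Schur sampling): they are mutually orthogonal orthogonal projections that sum to the identity. Consider the procedure that performs this measurement, obtaining $\mu$, and outputs the second part of $\mu$ (so it outputs $\ell$ when $\mu=(n-\ell,\ell)$). For every $x\in\{0,1\}^n$ with $|x|\le\lfloor n/2\rfloor$, every single-qubit unitary $U$ and every permutation $\sigma\in S_n$, this procedure, which does not depend on $x$, $U$ or $\sigma$, when applied to the state $D(\sigma)U^{\otimes n}|x\rangle$ outputs $|x|$ with probability exactly $$1-\frac{|x|}{n-|x|+1}.$$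 Moreover, if for each $n$ the string $x$ is random with $|x|$ uniformly distributed on $\{0,1,\dots,\lfloor n/2\rfloor\}$ (and $U$, $\sigma$ are arbitrary, possibly depending on $n$ and $x$), then the average probability that the procedure outputs $|x|$ correctly converges, as $n\to\infty$, to $2(1-\ln 2)$, which is $0.614$ to three decimal places. -/

import Mathlib

open scoped Matrix

noncomputable section

/-! ### Young diagrams with `n` boxes and the irreducible representations of `S_n` -/

/-- Young diagrams with `n` boxes, that is, partitions `λ ⊢ n`
(`μ.rowLen 0 ≥ μ.rowLen 1 ≥ …` are the parts). -/
abbrev Shape (n : ℕ) : Type := {μ : YoungDiagram // μ.card = n}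

theorem Shape.cells_subset {n : ℕ} (μ : Shape n) :
    μ.1.cells ⊆ Finset.range n ×ˢ Finset.range n := by
  rintro ⟨i, j⟩ h
  have hmem : (i, j) ∈ μ.1 := h
  have h1 : j < μ.1.rowLen i := YoungDiagram.mem_iff_lt_rowLen.1 hmem
  have h2 : i < μ.1.colLen j := YoungDiagram.mem_iff_lt_colLen.1 hmem
  have h3 : μ.1.rowLen i ≤ n := by
    rw [YoungDiagram.rowLen_eq_card]
    exact (Finset.card_le_card (Finset.filter_subset _ _)).trans μ.2.le
  have h4 : μ.1.colLen j ≤ n := by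
    rw [YoungDiagram.colLen_eq_card]
    exact (Finset.card_le_card (Finset.filter_subset _ _)).trans μ.2.le
  simp only [Finset.mem_product, Finset.mem_range]
  omega

instance Shape.finite (n : ℕ) : Finite (Shape n) :=
  Finite.of_injective
    (fun μ : Shape n =>
      (⟨μ.1.cells, Finset.mem_powerset.2 μ.cells_subset⟩ :
        ((Finset.range n ×ˢ Finset.range n).powerset : Finset (Finset (ℕ × ℕ)))))
    (fun _ _ h => Subtype.ext (YoungDiagram.ext (congrArg Subtype.val h)))

instance Shape.fintype (n : ℕ) : Fintype (Shape n) := Fintype.ofFinite _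

/-- A numbering of the boxes of `μ` by `Fin n` (a Young tableau of shape `μ`). A different choice
replaces the Young symmetrizer below by a conjugate and does not change the character. -/
def Shape.tableau {n : ℕ} (μ : Shape n) : μ.1.cells ≃ Fin n :=
  Finset.equivFinOfCardEq μ.2

/-- The permutations that preserve every row of the tableau. -/
def Shape.rowStabilizer {n : ℕ} (μ : Shape n) : Finset (Equiv.Perm (Fin n)) :=
  {p | ∀ i, (μ.tableau.symm (p i)).1.1 = (μ.tableau.symm i).1.1}

/-- The permutations that preserve every column of the tableau. -/
def Shape.colStabilizer {n : ℕ} (μ : Shape n) : Finset (Equiv.Perm (Fin n)) :=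
  {q | ∀ i, (μ.tableau.symm (q i)).1.2 = (μ.tableau.symm i).1.2}

/-- The Young symmetrizer `c_μ = (∑_{p ∈ R} p) (∑_{q ∈ C} sgn(q) q)` in `ℂ[S_n]`. -/
def Shape.youngSymmetrizer {n : ℕ} (μ : Shape n) : MonoidAlgebra ℂ (Equiv.Perm (Fin n)) :=
  (∑ p ∈ μ.rowStabilizer, MonoidAlgebra.single p (1 : ℂ)) *
    ∑ q ∈ μ.colStabilizer, MonoidAlgebra.single q ((Equiv.Perm.sign q : ℤ) : ℂ)

/-- The irrep `V_μ` of `S_n`: the left ideal `ℂ[S_n] c_μ`. -/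
abbrev Shape.Specht {n : ℕ} (μ : Shape n) : Type :=
  ↥(Ideal.span {μ.youngSymmetrizer} : Ideal (MonoidAlgebra ℂ (Equiv.Perm (Fin n))))

/-- The action of `S_n` on `V_μ`, by left multiplication. -/
def Shape.spechtRep {n : ℕ} (μ : Shape n) :
    Representation ℂ (Equiv.Perm (Fin n)) μ.Specht :=
  Representation.ofModule' μ.Specht

/-- The dimension `d_μ` of `V_μ`. -/
def Shape.dim {n : ℕ} (μ : Shape n) : ℕ := Module.finrank ℂ μ.Specht

/-- The character `χ_μ` of `V_μ`. -/
def Shape.character {n : ℕ} (μ : Shape n) (π : Equiv.Perm (Fin n)) : ℂ :=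
  μ.spechtRep.character π

/-! ### `n` qubits -/

/-- Bit strings of length `n`; they label the computational basis of `(ℂ²)^{⊗n}`. The Hamming
weight of `x` is `hammingNorm x`. -/
abbrev Bits (n : ℕ) : Type := Fin n → Fin 2

/-- Operators on `n` qubits, in the computational basis. -/
abbrev QubitOp (n : ℕ) : Type := Matrix (Bits n) (Bits n) ℂ

/-- `U^{⊗n}`. -/
def tensorPow (n : ℕ) (U : Matrix (Fin 2) (Fin 2) ℂ) : QubitOp n :=
  Matrix.of fun y x => ∏ i, U (y i) (x i)

/-- The operator `D(π)` that permutes the qubits,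
`D(π) |x_1 … x_n⟩ = |x_{π⁻¹(1)} … x_{π⁻¹(n)}⟩`. -/
def permOp {n : ℕ} (π : Equiv.Perm (Fin n)) : QubitOp n :=
  Matrix.of fun y x => if y = x ∘ ⇑π⁻¹ then 1 else 0

/-- The basis vector `|x⟩`. -/
def ket {n : ℕ} (x : Bits n) : Bits n → ℂ := Pi.single x 1

/-- The state `σ(U^{⊗n} |x⟩)`. -/
def scrambled {n : ℕ} (x : Bits n) (U : Matrix.unitaryGroup (Fin 2) ℂ)
    (σ : Equiv.Perm (Fin n)) : Bits n → ℂ :=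
  permOp σ *ᵥ (tensorPow n U.1 *ᵥ ket x)

/-! ### Measurements -/

/-- A projective measurement on `n` qubits with outcomes in `ι`. -/
structure ProjectiveMeasurement (n : ℕ) (ι : Type) [Fintype ι] where
  /-- the projector of each outcome -/
  proj : ι → QubitOp n
  isStarProjection : ∀ i, IsStarProjection (proj i)
  orthogonal : ∀ i j, i ≠ j → proj i * proj j = 0
  sum_eq_one : ∑ i, proj i = 1

/-- The probability `tr(P_i |ψ⟩⟨ψ|)` of the outcome `i` on the state `ψ`. -/
def ProjectiveMeasurement.outcomeProb {n : ℕ} {ι : Type} [Fintype ι]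
    (M : ProjectiveMeasurement n ι) (ψ : Bits n → ℂ) (i : ι) : ℝ :=
  (Matrix.trace (M.proj i * Matrix.vecMulVec ψ (star ψ))).re

/-- The probability that the procedure "measure `M`, obtain `i`, output `g i`" outputs `k`
on the state `ψ`. -/
def ProjectiveMeasurement.outputProb {n : ℕ} {ι : Type} [Fintype ι]
    (M : ProjectiveMeasurement n ι) (g : ι → ℕ) (ψ : Bits n → ℂ) (k : ℕ) : ℝ :=
  ∑ i with g i = k, M.outcomeProb ψ i

/-! ### Weak Schur sampling -/

/-- The operator `P_μ = (d_μ / n!) ∑_{π ∈ S_n} χ_μ(π) D(π)` on `n` qubits. -/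
def schurProjector {n : ℕ} (μ : Shape n) : QubitOp n :=
  ((μ.dim : ℂ) / (n.factorial : ℂ)) • ∑ π : Equiv.Perm (Fin n), μ.character π • permOp π

/-- `M` is weak Schur sampling: it measures the label `μ ⊢ n`. -/
def IsWeakSchurSampling {n : ℕ} (M : ProjectiveMeasurement n (Shape n)) : Prop :=
  ∀ μ, M.proj μ = schurProjector μ

/-- The guess made from the outcome `μ`: the second part of `μ`; it is `ℓ` for
`μ = (n - ℓ, ℓ)`. -/
def guess {n : ℕ} (μ : Shape n) : ℕ := μ.1.rowLen 1

end

/-! Write `c_μ² = κ c_μ` for the Young symmetrizer. On qubits `P_μ` is the image of the central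
element `e_μ = κ⁻² ∑ g c_μ g⁻¹` of the group algebra (`schurProjector_eq`). Von Neumann's lemma
makes `e_μ` idempotent, and a dominance argument on tableaux makes different `e_μ` orthogonal.
Central elements form a space of dimension at most the number of shapes, so the `e_μ` span it and
sum to `1` (`Shape.sum_centralIdempotent`). Their coefficients are real and invariant under
inversion, hence the `P_μ` are self-adjoint. Since `D(σ)` and `U^{⊗n}` commute with `P_μ`, only the
diagonal entry `P_μ x x` matters (`outcomeProb_scrambled`).

Let `V_k` be the span of the basis states of weight `k`, `L` the lowering operator, `R = L*` the
raising operator, and `Q_k` the sum of the `P_μ` with guess `k`. All of these `P_μ` commute with `L`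
and `R`. On `V_k` the guess never exceeds `k`, because column antisymmetrizers kill repeated bits;
on `V_k ∩ ker L` it is never below `k`, because row-invariant vectors there vanish
(`eq_zero_of_lowering_of_row_invariant`). So `Q_k` kills `V_{k-1}`, hence `R V_{k-1}`, and is the
identity on `V_k ∩ ker L`. For `k ≤ n/2` the `sl₂` relation makes `R` injective on `V_{k-1}`, and
`V_k = R V_{k-1} ⊕ (V_k ∩ ker L)`. Thus `Q_k` has trace `C(n,k) - C(n,k-1)` on `V_k`
(`trace_guessProj_mul_weightProj`). By permutation symmetry the `C(n,k)` strings share it equally,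
which gives `1 - k/(n-k+1)`.

The average over `k` is a difference of harmonic numbers, whose limit is `log 2`. -/

noncomputable section

/-! ### Rows and columns of the tableau -/

/-- The row of the tableau of `μ` that contains `i`. -/
def Shape.row {n : ℕ} (μ : Shape n) (i : Fin n) : ℕ := (μ.tableau.symm i).1.1

/-- The column of the tableau of `μ` that contains `i`. -/
def Shape.col {n : ℕ} (μ : Shape n) (i : Fin n) : ℕ := (μ.tableau.symm i).1.2

namespace Shape

variable {n : ℕ}

theorem row_col_mem (μ : Shape n) (i : Fin n) : (μ.row i, μ.col i) ∈ μ.1 :=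
  (μ.tableau.symm i).2

theorem exists_row_col (μ : Shape n) {a b : ℕ} (h : (a, b) ∈ μ.1) :
    ∃ i, μ.row i = a ∧ μ.col i = b :=
  ⟨μ.tableau ⟨(a, b), h⟩, by simp [row], by simp [col]⟩

theorem row_col_inj (μ : Shape n) {i j : Fin n} (hr : μ.row i = μ.row j)
    (hc : μ.col i = μ.col j) : i = j :=
  μ.tableau.symm.injective (Subtype.ext (Prod.ext hr hc))

theorem mem_rowStabilizer (μ : Shape n) (p : Equiv.Perm (Fin n)) :
    p ∈ μ.rowStabilizer ↔ ∀ i, μ.row (p i) = μ.row i := by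
  simp [rowStabilizer, row]

theorem mem_colStabilizer (μ : Shape n) (p : Equiv.Perm (Fin n)) :
    p ∈ μ.colStabilizer ↔ ∀ i, μ.col (p i) = μ.col i := by
  simp [colStabilizer, col]

open Finset in
-- The first `r` rows meet column `c` in `min r (colLen c)` boxes, and an `f` that is injective on
-- the column cannot take more values below `r`, nor more than the column has boxes.
theorem card_col_filter_le (μ : Shape n) (f : Fin n → ℕ)
    (hf : ∀ i j, μ.col i = μ.col j → f i = f j → i = j) (c r : ℕ) :
    #{i | μ.col i = c ∧ f i < r} ≤ #{i | μ.col i = c ∧ μ.row i < r} := by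
  rcases le_or_gt (μ.1.colLen c) r with h | h
  · refine card_le_card fun i hi => ?_
    simp only [mem_filter, mem_univ, true_and] at hi ⊢
    refine ⟨hi.1, lt_of_lt_of_le ?_ h⟩
    rw [← hi.1]
    exact YoungDiagram.mem_iff_lt_colLen.1 (μ.row_col_mem i)
  · calc #{i | μ.col i = c ∧ f i < r} ≤ #(range r) := by
          refine card_le_card_of_injOn f (fun i hi => ?_) (fun i hi j hj hij => ?_)
          · simp only [coe_filter, mem_univ, true_and, Set.mem_ofPred_eq] at hi
            simpa using hi.2
          · simp only [coe_filter, mem_univ, true_and, Set.mem_ofPred_eq] at hi hj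
            exact hf i j (hi.1.trans hj.1.symm) hij
      _ ≤ #(image μ.row {i | μ.col i = c ∧ μ.row i < r}) := by
          refine card_le_card fun s hs => ?_
          have hs' : s < r := by simpa using hs
          obtain ⟨i, h1, h2⟩ := μ.exists_row_col
            (YoungDiagram.mem_iff_lt_colLen.2 (hs'.trans h))
          simp only [mem_image, mem_filter, mem_univ, true_and]
          exact ⟨i, ⟨h2, h1 ▸ hs'⟩, h1⟩
      _ ≤ _ := card_image_le

open Finset in
theorem card_filter_eq_sum_col (μ : Shape n) (f : Fin n → ℕ) (r : ℕ) :
    #{i | f i < r} = ∑ c ∈ univ.image μ.col, #{i | μ.col i = c ∧ f i < r} := by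
  rw [card_eq_sum_card_fiberwise (f := μ.col) (t := univ.image μ.col) (by intro i _; simp)]
  refine sum_congr rfl fun c _ => ?_
  rw [filter_filter]
  simp only [and_comm]

open Finset in
theorem card_filter_le (μ : Shape n) (f : Fin n → ℕ)
    (hf : ∀ i j, μ.col i = μ.col j → f i = f j → i = j) (r : ℕ) :
    #{i | f i < r} ≤ #{i | μ.row i < r} := by
  rw [μ.card_filter_eq_sum_col f, μ.card_filter_eq_sum_col μ.row]
  exact sum_le_sum fun c _ => μ.card_col_filter_le f hf c r

open Finset in
theorem card_row_eq (μ : Shape n) (r : ℕ) : #{i | μ.row i = r} = μ.1.rowLen r := by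
  rw [← card_range (μ.1.rowLen r)]
  refine card_bij (fun i _ => μ.col i) (fun i hi => ?_) (fun i hi j hj h => ?_) (fun s hs => ?_)
  · simp only [mem_filter, mem_univ, true_and] at hi
    have := YoungDiagram.mem_iff_lt_rowLen.1 (μ.row_col_mem i)
    simpa [hi] using this
  · simp only [mem_filter, mem_univ, true_and] at hi hj
    exact μ.row_col_inj (hi.trans hj.symm) h
  · obtain ⟨i, h1, h2⟩ := μ.exists_row_col
      (YoungDiagram.mem_iff_lt_rowLen.2 (mem_range.1 hs))
    exact ⟨i, by simpa using h1, h2⟩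

open Finset in
theorem eq_of_card_filter_row (μ ν : Shape n)
    (h : ∀ r, #{i | μ.row i < r} = #{i | ν.row i < r}) : μ = ν := by
  have key : ∀ (κ : Shape n) (r : ℕ),
      #{i | κ.row i < r + 1} = #{i | κ.row i < r} + κ.1.rowLen r := by
    intro κ r
    rw [← κ.card_row_eq, ← card_union_of_disjoint]
    · congr 1
      ext i
      simp only [mem_filter, mem_univ, true_and, mem_union]
      omega
    · rw [disjoint_filter]
      intros; omega
  have hlen : ∀ r, μ.1.rowLen r = ν.1.rowLen r := by
    intro r
    have h1 := key μ r
    have h2 := key ν r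
    rw [h, h] at h1
    omega
  refine Subtype.ext (YoungDiagram.ext (Finset.ext fun ⟨a, b⟩ => ?_))
  rw [YoungDiagram.mem_cells, YoungDiagram.mem_cells, YoungDiagram.mem_iff_lt_rowLen,
    YoungDiagram.mem_iff_lt_rowLen, hlen]

open Finset in
-- Dominance order: if `g` spreads each row of `μ` over distinct columns of `ν`, the first `r` rows
-- of `μ` hold no more boxes than those of `ν`. Antisymmetry of this order then separates different
-- shapes.
theorem card_filter_row_le_of_perm (μ ν : Shape n) (g : Equiv.Perm (Fin n))
    (hg : ∀ i j, μ.row i = μ.row j → ν.col (g i) = ν.col (g j) → i = j) (r : ℕ) :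
    #{i | μ.row i < r} ≤ #{i | ν.row i < r} := by
  refine le_trans (le_of_eq ?_) (ν.card_filter_le (fun i => μ.row (g⁻¹ i)) ?_ r)
  · refine card_bij (fun i _ => g i) (by simp) (by simp) (fun i hi => ⟨g⁻¹ i, ?_, by simp⟩)
    simpa using hi
  · intro i j h1 h2
    exact g⁻¹.injective (hg _ _ h2 (by simpa using h1))

/-- Two shapes whose tableaux can be superposed, in both directions, without a pair of numbers
that lies in a row of one and a column of the other, are equal. -/
theorem eq_of_perms (μ ν : Shape n) (g h : Equiv.Perm (Fin n))
    (hg : ∀ i j, μ.row i = μ.row j → ν.col (g i) = ν.col (g j) → i = j)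
    (hh : ∀ i j, ν.row i = ν.row j → μ.col (h i) = μ.col (h j) → i = j) : μ = ν :=
  eq_of_card_filter_row μ ν fun r =>
    le_antisymm (card_filter_row_le_of_perm μ ν g hg r) (card_filter_row_le_of_perm ν μ h hh r)

open Finset in
/-- A relabelling that never moves two numbers of a row of the tableau from a common column is
a product of a row permutation and a column permutation. -/
theorem exists_row_mul_col (μ : Shape n) (g : Equiv.Perm (Fin n))
    (hg : ∀ i j, μ.row (g i) = μ.row (g j) → μ.col i = μ.col j → i = j) :
    ∃ p ∈ μ.rowStabilizer, ∃ q ∈ μ.colStabilizer, g = p * q := by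
  have hf : ∀ i j, μ.col i = μ.col j → (μ.row ∘ g) i = (μ.row ∘ g) j → i = j :=
    fun i j h1 h2 => hg i j h2 h1
  have htot : ∀ r, #{i | (μ.row ∘ g) i < r} = #{i | μ.row i < r} := by
    intro r
    refine card_bij (fun i _ => g i) (by simp) (by simp) (fun i hi => ⟨g⁻¹ i, ?_, by simp⟩)
    simpa using hi
  -- The totals over all columns agree and each column satisfies `≤`, so equality holds column by
  -- column.
  have hcol : ∀ c r, #{i | μ.col i = c ∧ (μ.row ∘ g) i < r} = #{i | μ.col i = c ∧ μ.row i < r} := by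
    intro c r
    by_cases hc : c ∈ univ.image μ.col
    · have h1 := htot r
      rw [μ.card_filter_eq_sum_col (μ.row ∘ g), μ.card_filter_eq_sum_col μ.row] at h1
      exact (sum_eq_sum_iff_of_le fun c _ => μ.card_col_filter_le _ hf c r).1 h1 c hc
    · have : ∀ i, μ.col i ≠ c := by simpa using hc
      simp [this]
  have hmem : ∀ i, (μ.row (g i), μ.col i) ∈ μ.1 := by
    intro i
    rw [YoungDiagram.mem_iff_lt_colLen]
    have h1 := hcol (μ.col i) (μ.1.colLen (μ.col i))
    have h2 : (univ.filter fun j => μ.col j = μ.col i ∧ μ.row j < μ.1.colLen (μ.col i)) =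
        univ.filter fun j => μ.col j = μ.col i := by
      ext j
      simp only [mem_filter, mem_univ, true_and, and_iff_left_iff_imp]
      intro hj
      rw [← hj]
      exact YoungDiagram.mem_iff_lt_colLen.1 (μ.row_col_mem j)
    rw [h2] at h1
    have h3 := eq_of_subset_of_card_le (s := {j | μ.col j = μ.col i ∧
      (μ.row ∘ g) j < μ.1.colLen (μ.col i)}) (t := {j | μ.col j = μ.col i})
      (fun j hj => by simp only [mem_filter, mem_univ, true_and] at hj ⊢; exact hj.1) h1.ge
    have h4 : i ∈ univ.filter fun j => μ.col j = μ.col i := by simp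
    rw [← h3] at h4
    simpa using h4
  -- `q i` sits in the row of `g i` and the column of `i`: thus `q` preserves columns, and `g * q⁻¹`
  -- preserves rows.
  choose q hq1 hq2 using fun i => μ.exists_row_col (hmem i)
  have hinj : Function.Injective q := by
    intro i j hij
    exact hg i j (by rw [← hq1, ← hq1, hij]) (by rw [← hq2, ← hq2 j, hij])
  let Q : Equiv.Perm (Fin n) := Equiv.ofBijective q (Finite.injective_iff_bijective.1 hinj)
  have hQ : ∀ i, Q i = q i := fun i => rfl
  refine ⟨g * Q⁻¹, ?_, Q, ?_, by simp⟩
  · rw [mem_rowStabilizer]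
    intro i
    rw [Equiv.Perm.mul_apply, ← hq1, ← hQ]
    simp
  · rw [mem_colStabilizer]
    exact hq2

end Shape

end

noncomputable section

/-! ### Group algebras of finite groups -/

namespace MonoidAlgebra

variable {G : Type} [Group G]

theorem eq_sum_coeff [Fintype G] (x : MonoidAlgebra ℂ G) : x = ∑ g, x.coeff g • single g (1 : ℂ) := by
  classical
  ext h
  simp [coeff_sum]

/-- The sum of the conjugates of an element of the group algebra. -/
def conjSum [Fintype G] : MonoidAlgebra ℂ G →ₗ[ℂ] MonoidAlgebra ℂ G where
  toFun x := ∑ g : G, single g (1 : ℂ) * x * single g⁻¹ 1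
  map_add' x y := by simp [mul_add, add_mul, Finset.sum_add_distrib]
  map_smul' r x := by simp [Finset.smul_sum]

variable [Fintype G]

theorem conjSum_apply (x : MonoidAlgebra ℂ G) :
    conjSum x = ∑ g : G, single g (1 : ℂ) * x * single g⁻¹ 1 := rfl

theorem coeff_conjSum (x : MonoidAlgebra ℂ G) (h : G) :
    (conjSum x).coeff h = ∑ g : G, x.coeff (g⁻¹ * h * g) := by
  rw [conjSum_apply, coeff_sum, Finset.sum_apply']
  exact Finset.sum_congr rfl fun g _ => by simp [mul_assoc]

theorem conjSum_mul_comm (x y : MonoidAlgebra ℂ G) : conjSum (x * y) = conjSum (y * x) := by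
  induction x using MonoidAlgebra.induction_linear with
  | zero => simp
  | add x x' hx hx' => rw [add_mul, mul_add, map_add, map_add, hx, hx']
  | single h r =>
    have key : conjSum (single h (1 : ℂ) * y) = conjSum (y * single h 1) := by
      rw [conjSum_apply, conjSum_apply, ← Equiv.sum_comp (Equiv.mulRight h⁻¹)]
      refine Finset.sum_congr rfl fun g _ => ?_
      simp only [Equiv.coe_mulRight, mul_inv_rev, inv_inv]
      have h1 : single (g * h⁻¹) (1 : ℂ) * single h 1 = single g 1 := by simp
      have h2 : single h (1 : ℂ) * single g⁻¹ 1 = single (h * g⁻¹) 1 := by simp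
      rw [← mul_assoc, h1, ← h2]
      simp only [mul_assoc]
    have h3 : single h r = r • single h (1 : ℂ) := by simp
    rw [h3, smul_mul_assoc, mul_smul_comm, map_smul, map_smul, key]

theorem commute_conjSum (x y : MonoidAlgebra ℂ G) : Commute y (conjSum x) := by
  induction y using MonoidAlgebra.induction_linear with
  | zero => exact Commute.zero_left _
  | add y y' hy hy' => exact hy.add_left hy'
  | single h r =>
    have key : single h (1 : ℂ) * conjSum x = conjSum x * single h 1 := by
      rw [conjSum_apply, Finset.mul_sum, Finset.sum_mul, ← Equiv.sum_comp (Equiv.mulLeft h⁻¹)]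
      refine Finset.sum_congr rfl fun g _ => ?_
      simp [← mul_assoc, mul_assoc (_ * x)]
    have h3 : single h r = r • single h (1 : ℂ) := by simp
    rw [h3]
    exact Commute.smul_left key r

theorem conjSum_mul_conjSum (x y : MonoidAlgebra ℂ G) :
    conjSum x * conjSum y = conjSum (x * conjSum y) := by
  rw [conjSum_apply x, Finset.sum_mul, conjSum_apply (x * _)]
  refine Finset.sum_congr rfl fun g _ => ?_
  rw [mul_assoc, (commute_conjSum y _).eq]
  simp only [mul_assoc]

/-- In the basis of group elements, `g ↦ h g x` has diagonal entry `x (g⁻¹ h⁻¹ g)`. -/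
theorem trace_mulLeft_mulRight (h : G) (x : MonoidAlgebra ℂ G) :
    LinearMap.trace ℂ (MonoidAlgebra ℂ G)
      (LinearMap.mulLeft ℂ (single h 1) ∘ₗ LinearMap.mulRight ℂ x) = (conjSum x).coeff h⁻¹ := by
  classical
  rw [LinearMap.trace_eq_matrix_trace ℂ (MonoidAlgebra.basis G ℂ), coeff_conjSum, Matrix.trace]
  refine Finset.sum_congr rfl fun g _ => ?_
  rw [Matrix.diag_apply, LinearMap.toMatrix_apply]
  change ((single h 1 * (MonoidAlgebra.basis G ℂ g * x) : MonoidAlgebra ℂ G)).coeff g = _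
  rw [basis_apply]
  simp [mul_assoc]

theorem trace_mulRight (x : MonoidAlgebra ℂ G) :
    LinearMap.trace ℂ (MonoidAlgebra ℂ G) (LinearMap.mulRight ℂ x) =
      Fintype.card G * x.coeff 1 := by
  have := trace_mulLeft_mulRight (1 : G) x
  rw [← one_def, LinearMap.mulLeft_one, LinearMap.id_comp, coeff_conjSum] at this
  simpa using this

/-- With `κ = 0`, right multiplication by `c` would be nilpotent and so of trace zero, but its trace
is `|G| c(1)`. -/
theorem ne_zero_of_mul_self_eq_smul {c : MonoidAlgebra ℂ G} (h1 : c.coeff 1 ≠ 0) {κ : ℂ}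
    (hc : c * c = κ • c) : κ ≠ 0 := by
  rintro rfl
  have hnil : IsNilpotent (LinearMap.mulRight ℂ c) := by
    refine ⟨2, LinearMap.ext fun x => ?_⟩
    simp [pow_two, mul_assoc, hc]
  have := (LinearMap.isNilpotent_trace_of_isNilpotent hnil).eq_zero
  rw [trace_mulRight] at this
  simp [h1] at this

theorem finite_ideal (I : Ideal (MonoidAlgebra ℂ G)) : Module.Finite ℂ I := by
  have : Module.Finite ℂ (MonoidAlgebra ℂ G) := Module.Finite.of_basis (MonoidAlgebra.basis G ℂ)
  exact inferInstanceAs (Module.Finite ℂ (I.restrictScalars ℂ))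

/-- The map `x ↦ κ⁻¹ h x c` has its image in the ideal and acts there as left multiplication by `h`,
so the character is its trace on the whole algebra. -/
theorem character_span_singleton {c : MonoidAlgebra ℂ G} {κ : ℂ} (hκ : κ ≠ 0)
    (hc : c * c = κ • c) (h : G) :
    (Representation.ofModule' (k := ℂ) (G := G) (Ideal.span {c} : Ideal (MonoidAlgebra ℂ G))).character h =
      κ⁻¹ * (conjSum c).coeff h⁻¹ := by
  have : Module.Finite ℂ (MonoidAlgebra ℂ G) := Module.Finite.of_basis (MonoidAlgebra.basis G ℂ)
  have hmem : ∀ x : MonoidAlgebra ℂ G, (LinearMap.mulLeft ℂ (single h 1) ∘ₗ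
      LinearMap.mulRight ℂ (κ⁻¹ • c)) x ∈ (Ideal.span {c}).restrictScalars ℂ := by
    intro x
    rw [Submodule.restrictScalars_mem, LinearMap.comp_apply, LinearMap.mulLeft_apply,
      LinearMap.mulRight_apply, mul_smul_comm, ← smul_mul_assoc]
    exact Ideal.mul_mem_left _ _ (Ideal.mul_mem_left _ _ (Ideal.subset_span rfl))
  have htr := LinearMap.trace_restrict_eq_of_forall_mem _ _ hmem
  rw [trace_mulLeft_mulRight, map_smul, coeff_smul_apply, smul_eq_mul] at htr
  rw [← htr]
  refine congrArg (LinearMap.trace ℂ (Ideal.span {c} : Ideal (MonoidAlgebra ℂ G))) ?_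
  refine LinearMap.ext fun ⟨x, hx⟩ => Subtype.ext ?_
  obtain ⟨y, rfl⟩ := Ideal.mem_span_singleton'.1 hx
  change single h (1 : ℂ) * (y * c) = single h 1 * (y * c * κ⁻¹ • c)
  rw [mul_smul_comm, mul_assoc y, hc, mul_smul_comm, mul_smul_comm, mul_smul_comm, smul_smul, inv_mul_cancel₀ hκ, one_smul]

end MonoidAlgebra

end

noncomputable section

/-! ### Young symmetrizers -/

theorem eq_zero_of_eq_neg_self {V : Type*} [AddCommGroup V] [Module ℂ V] {x : V} (h : x = -x) :
    x = 0 := by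
  have h2 : (2 : ℂ) • x = 0 := by
    rw [two_smul]
    nth_rewrite 2 [h]
    exact add_neg_cancel x
  exact (smul_eq_zero.1 h2).resolve_left two_ne_zero

namespace Shape

open MonoidAlgebra Equiv

variable {n : ℕ}

/-- The sum of the row permutations. -/
def rowSum (μ : Shape n) : MonoidAlgebra ℂ (Perm (Fin n)) :=
  ∑ p ∈ μ.rowStabilizer, single p (1 : ℂ)

/-- The signed sum of the column permutations. -/
def colSum (μ : Shape n) : MonoidAlgebra ℂ (Perm (Fin n)) :=
  ∑ q ∈ μ.colStabilizer, single q ((Perm.sign q : ℤ) : ℂ)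

theorem youngSymmetrizer_eq (μ : Shape n) : μ.youngSymmetrizer = μ.rowSum * μ.colSum := rfl

theorem mul_mem_rowStabilizer (μ : Shape n) {p q : Perm (Fin n)} (hp : p ∈ μ.rowStabilizer)
    (hq : q ∈ μ.rowStabilizer) : p * q ∈ μ.rowStabilizer := by
  rw [mem_rowStabilizer] at *
  intro i
  rw [Perm.mul_apply, hp, hq]

theorem inv_mem_rowStabilizer (μ : Shape n) {p : Perm (Fin n)} (hp : p ∈ μ.rowStabilizer) :
    p⁻¹ ∈ μ.rowStabilizer := by
  rw [mem_rowStabilizer] at *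
  intro i
  rw [← hp (p⁻¹ i)]
  simp

theorem mul_mem_colStabilizer (μ : Shape n) {p q : Perm (Fin n)} (hp : p ∈ μ.colStabilizer)
    (hq : q ∈ μ.colStabilizer) : p * q ∈ μ.colStabilizer := by
  rw [mem_colStabilizer] at *
  intro i
  rw [Perm.mul_apply, hp, hq]

theorem inv_mem_colStabilizer (μ : Shape n) {p : Perm (Fin n)} (hp : p ∈ μ.colStabilizer) :
    p⁻¹ ∈ μ.colStabilizer := by
  rw [mem_colStabilizer] at *
  intro i
  rw [← hp (p⁻¹ i)]
  simp

theorem swap_mem_rowStabilizer (μ : Shape n) {i j : Fin n} (h : μ.row i = μ.row j) :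
    swap i j ∈ μ.rowStabilizer := by
  rw [mem_rowStabilizer]
  intro k
  rw [swap_apply_def]
  split_ifs with h1 h2
  · rw [h1, h]
  · rw [h2, h]
  · rfl

theorem swap_mem_colStabilizer (μ : Shape n) {i j : Fin n} (h : μ.col i = μ.col j) :
    swap i j ∈ μ.colStabilizer := by
  rw [mem_colStabilizer]
  intro k
  rw [swap_apply_def]
  split_ifs with h1 h2
  · rw [h1, h]
  · rw [h2, h]
  · rfl

theorem rowSum_mul_single (μ : Shape n) {p : Perm (Fin n)} (hp : p ∈ μ.rowStabilizer) :
    μ.rowSum * single p 1 = μ.rowSum := by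
  rw [rowSum, Finset.sum_mul]
  refine Finset.sum_bij (fun q _ => q * p) (fun q hq => μ.mul_mem_rowStabilizer hq hp)
    (fun _ _ _ _ h => mul_right_cancel h)
    (fun q hq => ⟨q * p⁻¹, μ.mul_mem_rowStabilizer hq (μ.inv_mem_rowStabilizer hp), by simp⟩)
    (fun q _ => by simp)

theorem single_mul_rowSum (μ : Shape n) {p : Perm (Fin n)} (hp : p ∈ μ.rowStabilizer) :
    single p 1 * μ.rowSum = μ.rowSum := by
  rw [rowSum, Finset.mul_sum]
  refine Finset.sum_bij (fun q _ => p * q) (fun q hq => μ.mul_mem_rowStabilizer hp hq)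
    (fun _ _ _ _ h => mul_left_cancel h)
    (fun q hq => ⟨p⁻¹ * q, μ.mul_mem_rowStabilizer (μ.inv_mem_rowStabilizer hp) hq, by simp⟩)
    (fun q _ => by simp)

theorem colSum_mul_single (μ : Shape n) {p : Perm (Fin n)} (hp : p ∈ μ.colStabilizer) :
    μ.colSum * single p 1 = ((Perm.sign p : ℤ) : ℂ) • μ.colSum := by
  rw [colSum, Finset.sum_mul, Finset.smul_sum]
  refine Finset.sum_bij (fun q _ => q * p) (fun q hq => μ.mul_mem_colStabilizer hq hp)
    (fun _ _ _ _ h => mul_right_cancel h)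
    (fun q hq => ⟨q * p⁻¹, μ.mul_mem_colStabilizer hq (μ.inv_mem_colStabilizer hp), by simp⟩)
    (fun q _ => ?_)
  rcases Int.units_eq_one_or (Perm.sign p) with h | h <;> simp [h]

theorem single_mul_colSum (μ : Shape n) {p : Perm (Fin n)} (hp : p ∈ μ.colStabilizer) :
    single p 1 * μ.colSum = ((Perm.sign p : ℤ) : ℂ) • μ.colSum := by
  rw [colSum, Finset.mul_sum, Finset.smul_sum]
  refine Finset.sum_bij (fun q _ => p * q) (fun q hq => μ.mul_mem_colStabilizer hp hq)
    (fun _ _ _ _ h => mul_left_cancel h)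
    (fun q hq => ⟨p⁻¹ * q, μ.mul_mem_colStabilizer (μ.inv_mem_colStabilizer hp) hq, by simp⟩)
    (fun q _ => ?_)
  rcases Int.units_eq_one_or (Perm.sign p) with h | h <;> simp [h]

/-- The transposition of `i` and `j` is absorbed by the row sum with sign `+` and, carried across
`g`, by the column sum with sign `-`. -/
theorem colSum_mul_rowSum_eq_zero (μ ν : Shape n) (g : Perm (Fin n)) {i j : Fin n} (hij : i ≠ j)
    (hr : ν.row i = ν.row j) (hc : μ.col (g i) = μ.col (g j)) :
    μ.colSum * single g 1 * ν.rowSum = 0 := by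
  have h1 : μ.colSum * single (swap (g i) (g j)) 1 = -μ.colSum := by
    rw [μ.colSum_mul_single (μ.swap_mem_colStabilizer hc),
      Perm.sign_swap (g.injective.ne hij)]
    simp
  have h2 : single g (1 : ℂ) * single (swap i j) 1 = single (swap (g i) (g j)) 1 * single g 1 := by
    rw [single_mul_single, single_mul_single, mul_swap_eq_swap_mul]
  have h3 : μ.colSum * single g 1 * ν.rowSum = -(μ.colSum * single g 1 * ν.rowSum) := by
    conv_lhs => rw [← ν.single_mul_rowSum (ν.swap_mem_rowStabilizer hr)]
    rw [← mul_assoc, mul_assoc μ.colSum, h2, ← mul_assoc, h1, neg_mul, neg_mul]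
  exact eq_zero_of_eq_neg_self h3

theorem rowSum_mul_colSum_eq_zero (μ : Shape n) (g : Perm (Fin n)) {i j : Fin n} (hij : i ≠ j)
    (hr : μ.row (g i) = μ.row (g j)) (hc : μ.col i = μ.col j) :
    μ.rowSum * single g 1 * μ.colSum = 0 := by
  have h1 : single (swap i j) 1 * μ.colSum = -μ.colSum := by
    rw [μ.single_mul_colSum (μ.swap_mem_colStabilizer hc), Perm.sign_swap hij]
    simp
  have h2 : single (swap (g i) (g j)) (1 : ℂ) * single g 1 = single g 1 * single (swap i j) 1 := by
    rw [single_mul_single, single_mul_single, mul_swap_eq_swap_mul]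
  have h3 : μ.rowSum * single g 1 * μ.colSum = -(μ.rowSum * single g 1 * μ.colSum) := by
    conv_lhs => rw [← μ.rowSum_mul_single (μ.swap_mem_rowStabilizer hr)]
    rw [mul_assoc μ.rowSum, h2, ← mul_assoc, mul_assoc _ _ μ.colSum, h1, mul_neg]
  exact eq_zero_of_eq_neg_self h3

/-- Von Neumann's lemma. -/
theorem rowSum_mul_mul_colSum (μ : Shape n) (x : MonoidAlgebra ℂ (Perm (Fin n))) :
    ∃ r : ℂ, μ.rowSum * x * μ.colSum = r • μ.youngSymmetrizer := by
  induction x using MonoidAlgebra.induction_linear with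
  | zero => exact ⟨0, by simp⟩
  | add x y hx hy =>
    obtain ⟨r, hr⟩ := hx
    obtain ⟨s, hs⟩ := hy
    exact ⟨r + s, by rw [mul_add, add_mul, hr, hs, add_smul]⟩
  | single g r =>
    have hg : single g r = r • single g (1 : ℂ) := by simp
    by_cases h : ∀ i j, μ.row (g i) = μ.row (g j) → μ.col i = μ.col j → i = j
    -- Either `g = p q`, and both factors are absorbed up to the sign of `q`, or a pair in a common
    -- row and column makes the product vanish.
    · obtain ⟨p, hp, q, hq, rfl⟩ := μ.exists_row_mul_col g h
      refine ⟨r * ((Perm.sign q : ℤ) : ℂ), ?_⟩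
      have hpq : single (p * q) (1 : ℂ) = single p 1 * single q 1 := by simp
      rw [hg, mul_smul_comm, smul_mul_assoc, hpq, ← mul_assoc, μ.rowSum_mul_single hp, mul_assoc,
        μ.single_mul_colSum hq, mul_smul_comm, smul_smul, youngSymmetrizer_eq]
    · push Not at h
      obtain ⟨i, j, h1, h2, h3⟩ := h
      refine ⟨0, ?_⟩
      rw [hg, mul_smul_comm, smul_mul_assoc, μ.rowSum_mul_colSum_eq_zero g h3 h1 h2]
      simp

theorem youngSymmetrizer_mul_mul (μ : Shape n) (x : MonoidAlgebra ℂ (Perm (Fin n))) :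
    ∃ r : ℂ, μ.youngSymmetrizer * x * μ.youngSymmetrizer = r • μ.youngSymmetrizer := by
  obtain ⟨r, hr⟩ := μ.rowSum_mul_mul_colSum (μ.colSum * x * μ.rowSum)
  exact ⟨r, by rw [← hr, youngSymmetrizer_eq]; simp only [mul_assoc]⟩

theorem colSum_mul_mul_rowSum (μ ν : Shape n)
    (h : ∀ g : Perm (Fin n), ∃ i j, i ≠ j ∧ ν.row i = ν.row j ∧ μ.col (g i) = μ.col (g j))
    (x : MonoidAlgebra ℂ (Perm (Fin n))) : μ.colSum * x * ν.rowSum = 0 := by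
  induction x using MonoidAlgebra.induction_linear with
  | zero => simp
  | add x y hx hy => rw [mul_add, add_mul, hx, hy, add_zero]
  | single g r =>
    have hg : single g r = r • single g (1 : ℂ) := by simp
    obtain ⟨i, j, h1, h2, h3⟩ := h g
    rw [hg, mul_smul_comm, smul_mul_assoc, μ.colSum_mul_rowSum_eq_zero ν g h1 h2 h3, smul_zero]

/-- Only the identity preserves both rows and columns, so `p * q = 1` has a single solution. -/
theorem coeff_one_youngSymmetrizer (μ : Shape n) : μ.youngSymmetrizer.coeff 1 = 1 := by
  classical
  have h1 : (1 : Perm (Fin n)) ∈ μ.colStabilizer := by simp [mem_colStabilizer]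
  have h2 : (1 : Perm (Fin n)) ∈ μ.rowStabilizer := by simp [mem_rowStabilizer]
  have key : ∀ p ∈ μ.rowStabilizer, ∀ q ∈ μ.colStabilizer, p * q = 1 → q = 1 := by
    intro p hp q hq hpq
    have hp' : p⁻¹ = q := inv_eq_of_mul_eq_one_right hpq
    have hq' := μ.inv_mem_rowStabilizer hp
    rw [hp', mem_rowStabilizer] at hq'
    rw [mem_colStabilizer] at hq
    exact Equiv.ext fun i => μ.row_col_inj (hq' i) (hq i)
  rw [youngSymmetrizer_eq, rowSum, colSum, Finset.sum_mul_sum]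
  simp only [single_mul_single, coeff_sum, Finsupp.finsetSum_apply, coeff_single]
  rw [Finset.sum_eq_single_of_mem 1 h2, Finset.sum_eq_single_of_mem 1 h1]
  · simp
  · intro q hq hq1
    simp [hq1]
  · intro p hp hp1
    refine Finset.sum_eq_zero fun q hq => Finsupp.single_eq_of_ne fun h => hp1 ?_
    have := key p hp q hq h.symm
    rw [this, mul_one] at h
    exact h.symm

theorem exists_youngSymmetrizer_mul_self (μ : Shape n) :
    ∃ κ : ℂ, κ ≠ 0 ∧ μ.youngSymmetrizer * μ.youngSymmetrizer = κ • μ.youngSymmetrizer := by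
  obtain ⟨κ, hκ⟩ := μ.youngSymmetrizer_mul_mul 1
  rw [mul_one] at hκ
  exact ⟨κ, ne_zero_of_mul_self_eq_smul (by rw [coeff_one_youngSymmetrizer]; exact one_ne_zero) hκ, hκ⟩

/-- The nonzero scalar `κ` with `c_μ² = κ c_μ`. -/
def hookProduct (μ : Shape n) : ℂ := μ.exists_youngSymmetrizer_mul_self.choose

theorem hookProduct_ne_zero (μ : Shape n) : μ.hookProduct ≠ 0 :=
  μ.exists_youngSymmetrizer_mul_self.choose_spec.1

theorem youngSymmetrizer_mul_self (μ : Shape n) :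
    μ.youngSymmetrizer * μ.youngSymmetrizer = μ.hookProduct • μ.youngSymmetrizer :=
  μ.exists_youngSymmetrizer_mul_self.choose_spec.2

theorem character_eq (μ : Shape n) (g : Perm (Fin n)) :
    μ.character g = μ.hookProduct⁻¹ * (conjSum μ.youngSymmetrizer).coeff g⁻¹ :=
  character_span_singleton μ.hookProduct_ne_zero μ.youngSymmetrizer_mul_self g

theorem dim_eq (μ : Shape n) : (μ.dim : ℂ) = μ.hookProduct⁻¹ * n.factorial := by
  have h := μ.character_eq 1
  have : Module.Finite ℂ μ.Specht := finite_ideal _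
  rw [character, Representation.char_one, coeff_conjSum] at h
  rw [dim, h]
  simp [coeff_one_youngSymmetrizer, Fintype.card_perm]

/-! ### Central idempotents -/

/-- The central idempotent of `ℂ[S_n]` labelled by `μ`. -/
def centralIdempotent (μ : Shape n) : MonoidAlgebra ℂ (Perm (Fin n)) :=
  (μ.hookProduct⁻¹ * μ.hookProduct⁻¹) • conjSum μ.youngSymmetrizer

theorem commute_centralIdempotent (μ : Shape n) (x : MonoidAlgebra ℂ (Perm (Fin n))) :
    Commute x μ.centralIdempotent :=
  (commute_conjSum _ x).smul_right _

/-- By von Neumann's lemma `c g c` is a multiple of `c`, namely `κ c(g⁻¹) c`. Summing `c g c g⁻¹`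
over `g` reassembles `κ c · c = κ² c`. -/
theorem youngSymmetrizer_mul_conjSum (μ : Shape n) :
    μ.youngSymmetrizer * conjSum μ.youngSymmetrizer =
      (μ.hookProduct * μ.hookProduct) • μ.youngSymmetrizer := by
  set c := μ.youngSymmetrizer with hc
  have h1 : ∀ g : Perm (Fin n), c * single g 1 * c = (μ.hookProduct * c.coeff g⁻¹) • c := by
    intro g
    obtain ⟨r, hr⟩ := μ.youngSymmetrizer_mul_mul (single g 1)
    rw [← hc] at hr
    -- The identity coefficient of `conjSum` is a trace form; its cyclicity determines the scalar.
    have h2 : (conjSum (c * single g 1 * c)).coeff 1 = (conjSum (c * c * single g 1)).coeff 1 := by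
      rw [conjSum_mul_comm, mul_assoc, ← mul_assoc]
    rw [hr, μ.youngSymmetrizer_mul_self, coeff_conjSum, coeff_conjSum] at h2
    simp [← hc, hc ▸ μ.coeff_one_youngSymmetrizer] at h2
    rw [hr, h2]
  rw [conjSum_apply, Finset.mul_sum]
  simp only [← mul_assoc, h1, smul_mul_assoc]
  have h3 : c * ∑ g : Perm (Fin n), c.coeff g⁻¹ • single g⁻¹ (1 : ℂ) = μ.hookProduct • c := by
    have hs : ∑ g : Perm (Fin n), c.coeff g⁻¹ • single g⁻¹ (1 : ℂ) = c :=
      (Equiv.sum_comp (Equiv.inv (Perm (Fin n))) fun g => c.coeff g • single g (1 : ℂ)).trans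
        (eq_sum_coeff c).symm
    rw [hs, μ.youngSymmetrizer_mul_self]
  rw [mul_smul, ← h3, Finset.mul_sum, Finset.smul_sum]
  simp only [mul_smul_comm, smul_smul]

theorem centralIdempotent_mul_self (μ : Shape n) :
    μ.centralIdempotent * μ.centralIdempotent = μ.centralIdempotent := by
  have := μ.hookProduct_ne_zero
  rw [centralIdempotent, smul_mul_smul_comm, conjSum_mul_conjSum, youngSymmetrizer_mul_conjSum,
    map_smul, smul_smul]
  congr 1
  field_simp

theorem conjSum_mul_conjSum_eq_zero (μ ν : Shape n)
    (h : ∀ g : Perm (Fin n), ∃ i j, i ≠ j ∧ ν.row i = ν.row j ∧ μ.col (g i) = μ.col (g j)) :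
    conjSum μ.youngSymmetrizer * conjSum ν.youngSymmetrizer = 0 := by
  rw [conjSum_mul_conjSum, conjSum_apply ν.youngSymmetrizer, Finset.mul_sum,
    Finset.sum_eq_zero, map_zero]
  intro g _
  have h1 := μ.colSum_mul_mul_rowSum ν h (single g 1)
  rw [youngSymmetrizer_eq, youngSymmetrizer_eq]
  calc _ = μ.rowSum * (μ.colSum * single g 1 * ν.rowSum) * ν.colSum * single g⁻¹ 1 := by
        simp only [mul_assoc]
    _ = 0 := by rw [h1]; simp

/-- If neither order of the factors vanished termwise, the two tableaux could be superposed in both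
directions, and `eq_of_perms` would force equal shapes. -/
theorem centralIdempotent_mul_of_ne {μ ν : Shape n} (hne : μ ≠ ν) :
    μ.centralIdempotent * ν.centralIdempotent = 0 := by
  rw [centralIdempotent, centralIdempotent, smul_mul_smul_comm]
  by_cases h1 : ∀ g : Perm (Fin n), ∃ i j, i ≠ j ∧ ν.row i = ν.row j ∧ μ.col (g i) = μ.col (g j)
  · rw [conjSum_mul_conjSum_eq_zero μ ν h1, smul_zero]
  by_cases h2 : ∀ g : Perm (Fin n), ∃ i j, i ≠ j ∧ μ.row i = μ.row j ∧ ν.col (g i) = ν.col (g j)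
  · rw [(commute_conjSum _ _).eq, conjSum_mul_conjSum_eq_zero ν μ h2, smul_zero]
  push Not at h1 h2
  obtain ⟨g, hg⟩ := h1
  obtain ⟨h, hh⟩ := h2
  refine absurd (eq_of_perms μ ν h g (fun i j hr hc => ?_) fun i j hr hc => ?_) hne
  · by_contra hij
    exact hh i j hij hr hc
  · by_contra hij
    exact hg i j hij hr hc

theorem coeff_one_centralIdempotent_ne_zero (μ : Shape n) : μ.centralIdempotent.coeff 1 ≠ 0 := by
  rw [centralIdempotent, coeff_smul_apply, coeff_conjSum]
  simp [coeff_one_youngSymmetrizer, hookProduct_ne_zero]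

theorem centralIdempotent_ne_zero (μ : Shape n) : μ.centralIdempotent ≠ 0 := by
  intro h
  apply μ.coeff_one_centralIdempotent_ne_zero
  simp [h]

/-- Allows the vanishing of `P_μ` on a vector to be tested with the row sum as well as with the
column sum. -/
theorem conjSum_colSum_mul_rowSum (μ : Shape n) :
    conjSum (μ.colSum * μ.rowSum) = conjSum μ.youngSymmetrizer := by
  rw [conjSum_mul_comm, youngSymmetrizer_eq]

end Shape

end

noncomputable section

/-! ### Completeness of the central idempotents -/

namespace Shape

open MonoidAlgebra Equiv

variable {n : ℕ}

theorem card_cellsOfRowLens (w : List ℕ) : (YoungDiagram.cellsOfRowLens w).card = w.sum := by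
  induction w with
  | nil => rfl
  | cons a w ih =>
    rw [YoungDiagram.cellsOfRowLens, Finset.card_union_of_disjoint, Finset.card_map, ih,
      Finset.card_product, Finset.card_range, List.sum_cons, Finset.card_singleton, one_mul]
    rw [Finset.disjoint_left]
    rintro ⟨i, j⟩ h1 h2
    simp only [Finset.mem_product, Finset.mem_singleton] at h1
    obtain ⟨⟨i', j'⟩, -, h3⟩ := Finset.mem_map.1 h2
    have := congrArg Prod.fst h3
    simp at this
    omega

/-- The shape whose row lengths are the parts of a partition. -/
def ofPartition (p : n.Partition) : Shape n :=
  ⟨YoungDiagram.ofRowLens (p.parts.sort (· ≥ ·)) (Multiset.pairwise_sort _ _).sortedGE, by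
    refine (card_cellsOfRowLens _).trans ?_
    rw [← Multiset.sum_coe, Multiset.sort_eq, p.parts_sum]⟩

theorem ofPartition_injective : Function.Injective (ofPartition (n := n)) := by
  intro p q h
  have h1 : ∀ r : n.Partition, (ofPartition r).1.rowLens = r.parts.sort (· ≥ ·) := fun r =>
    YoungDiagram.rowLens_ofRowLens_eq_self (hw := (Multiset.pairwise_sort _ _).sortedGE) fun x hx => r.parts_pos ((Multiset.mem_sort _).1 hx)
  have h2 : p.parts.sort (· ≥ ·) = q.parts.sort (· ≥ ·) := by rw [← h1, ← h1, h]
  refine Nat.Partition.ext ?_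
  rw [← Multiset.sort_eq p.parts (· ≥ ·), h2, Multiset.sort_eq]

/-- The cycle type of a permutation, as a shape. -/
def ofPerm (σ : Perm (Fin n)) : Shape n :=
  ⟨(ofPartition σ.partition).1, (ofPartition σ.partition).2.trans (Fintype.card_fin n)⟩

theorem isConj_of_ofPerm_eq {σ τ : Perm (Fin n)} (h : ofPerm σ = ofPerm τ) : IsConj σ τ := by
  rw [Perm.partition_eq_of_isConj]
  have h1 : (ofPerm σ).1 = (ofPerm τ).1 := by rw [h]
  exact ofPartition_injective (Subtype.ext h1)

/-- The element of the group algebra with prescribed coefficients on the conjugacy classes. -/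
def classElement (n : ℕ) : (Shape n → ℂ) →ₗ[ℂ] MonoidAlgebra ℂ (Perm (Fin n)) where
  toFun f := ∑ σ : Perm (Fin n), f (ofPerm σ) • single σ (1 : ℂ)
  map_add' f g := by simp only [Pi.add_apply, add_smul, Finset.sum_add_distrib]
  map_smul' r f := by
    simp only [Pi.smul_apply, Finset.smul_sum, smul_smul, smul_eq_mul, RingHom.id_apply]

/-- A central element is constant on conjugacy classes, and `ofPerm` separates these; its values at
shapes that are not attained are irrelevant and set to `0`. -/
theorem mem_range_classElement {x : MonoidAlgebra ℂ (Perm (Fin n))} (hx : ∀ y, Commute y x) :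
    x ∈ LinearMap.range (classElement n) := by
  have hfac : Function.FactorsThrough x.coeff (ofPerm (n := n)) := by
    intro σ τ h
    obtain ⟨g, hg⟩ := isConj_iff.1 (isConj_of_ofPerm_eq h)
    have h1 : (single g (1 : ℂ) * x).coeff (g * σ) = (x * single g 1).coeff (g * σ) := by
      rw [(hx _).eq]
    simpa [← mul_assoc, hg] using h1
  refine ⟨Function.extend ofPerm x.coeff 0, ?_⟩
  conv_rhs => rw [eq_sum_coeff x]
  exact Finset.sum_congr rfl fun σ _ => by rw [hfac.extend_apply]

theorem linearIndependent_centralIdempotent :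
    LinearIndependent ℂ (centralIdempotent (n := n)) := by
  classical
  rw [Fintype.linearIndependent_iff]
  intro r hr μ
  have h := congrArg (· * μ.centralIdempotent) hr
  simp only [Finset.sum_mul, zero_mul, smul_mul_assoc] at h
  rw [Finset.sum_eq_single μ (fun ν _ hν => by rw [centralIdempotent_mul_of_ne hν, smul_zero])
    (by simp), centralIdempotent_mul_self] at h
  exact (smul_eq_zero.1 h).resolve_right μ.centralIdempotent_ne_zero

/-- Dimension count: the `e_μ` are independent, and their number bounds the dimension of a space
containing every central element. Hence `1 = ∑ r_μ e_μ`, and multiplying by `e_μ` gives `r_μ e_μ =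
e_μ`. -/
theorem sum_centralIdempotent : ∑ μ : Shape n, μ.centralIdempotent = 1 := by
  classical
  have hspan : Submodule.span ℂ (Set.range (centralIdempotent (n := n))) =
      LinearMap.range (classElement n) := by
    refine Submodule.eq_of_le_of_finrank_le ?_ ?_
    · rw [Submodule.span_le]
      rintro _ ⟨μ, rfl⟩
      exact mem_range_classElement μ.commute_centralIdempotent
    · rw [finrank_span_eq_card linearIndependent_centralIdempotent]
      refine (LinearMap.finrank_range_le _).trans ?_
      simp
  have h1 : (1 : MonoidAlgebra ℂ (Perm (Fin n))) ∈
      Submodule.span ℂ (Set.range (centralIdempotent (n := n))) := by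
    rw [hspan]
    exact mem_range_classElement Commute.one_right
  obtain ⟨r, hr⟩ := (Submodule.mem_span_range_iff_exists_fun ℂ).1 h1
  rw [← hr]
  refine Finset.sum_congr rfl fun μ _ => ?_
  have h := congrArg (· * μ.centralIdempotent) hr
  simp only [Finset.sum_mul, one_mul, smul_mul_assoc] at h
  rw [Finset.sum_eq_single μ (fun ν _ hν => by rw [centralIdempotent_mul_of_ne hν, smul_zero])
    (by simp), centralIdempotent_mul_self] at h
  exact h.symm

end Shape

/-! ### The operators on qubits -/

section Qubits

open MonoidAlgebra Equiv

variable {n : ℕ}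

theorem permOp_mul (π σ : Perm (Fin n)) : permOp (π * σ) = permOp π * permOp σ := by
  ext y x
  simp only [permOp, Matrix.mul_apply, Matrix.of_apply, ite_mul, one_mul, zero_mul]
  rw [Finset.sum_eq_single (x ∘ ⇑σ⁻¹)]
  · simp [Function.comp_assoc, Perm.coe_mul]
  · intro z _ hz
    rw [if_neg hz, ite_self]
  · simp

theorem permOp_one : permOp (1 : Perm (Fin n)) = 1 := by
  ext y x
  simp [permOp, Matrix.one_apply]

/-- The representation of the group algebra of `S_n` on `n` qubits. -/
def permAlg (n : ℕ) : MonoidAlgebra ℂ (Perm (Fin n)) →ₐ[ℂ] QubitOp n :=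
  MonoidAlgebra.lift ℂ (QubitOp n) (Perm (Fin n))
    { toFun := permOp, map_one' := permOp_one, map_mul' := permOp_mul }

theorem permAlg_single (σ : Perm (Fin n)) (r : ℂ) : permAlg n (single σ r) = r • permOp σ := by
  rw [permAlg, lift_single]
  rfl

/-- Every permutation is conjugate to its inverse, so the inverse in `character_eq` can be dropped.
-/
theorem Shape.character_eq_coeff (μ : Shape n) (σ : Perm (Fin n)) :
    μ.character σ = μ.hookProduct⁻¹ * (conjSum μ.youngSymmetrizer).coeff σ := by
  have h : IsConj σ⁻¹ σ := by rw [Perm.isConj_iff_cycleType_eq, Perm.cycleType_inv]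
  obtain ⟨τ, hτ⟩ := isConj_iff.1 h
  have h1 : (single τ (1 : ℂ) * conjSum μ.youngSymmetrizer).coeff (τ * σ⁻¹) =
      (conjSum μ.youngSymmetrizer * single τ 1).coeff (τ * σ⁻¹) := by
    rw [(commute_conjSum _ _).eq]
  rw [μ.character_eq]
  congr 1
  simpa [hτ] using h1

theorem schurProjector_eq (μ : Shape n) : schurProjector μ = permAlg n μ.centralIdempotent := by
  have h0 : (n.factorial : ℂ) ≠ 0 := Nat.cast_ne_zero.2 n.factorial_ne_zero
  rw [schurProjector, Shape.centralIdempotent, map_smul, μ.dim_eq,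
    eq_sum_coeff (conjSum μ.youngSymmetrizer), map_sum, mul_div_assoc, div_self h0, mul_one,
    mul_smul]
  congr 1
  rw [Finset.smul_sum]
  refine Finset.sum_congr rfl fun σ _ => ?_
  rw [map_smul, permAlg_single, one_smul, smul_smul, μ.character_eq_coeff]

end Qubits

end

/-! ### Weak Schur sampling as a projective measurement, and its invariance under scrambling -/

noncomputable section

section Measurement

open MonoidAlgebra Equiv

variable {n : ℕ}

/-- Complex conjugation of the coefficients. -/
def MonoidAlgebra.conjCoeff (G : Type) [Group G] : MonoidAlgebra ℂ G →+* MonoidAlgebra ℂ G :=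
  MonoidAlgebra.mapRingHom G (starRingEnd ℂ)

theorem MonoidAlgebra.coeff_conjCoeff {G : Type} [Group G] (x : MonoidAlgebra ℂ G) (g : G) :
    (conjCoeff G x).coeff g = starRingEnd ℂ (x.coeff g) := by
  simp [conjCoeff]

theorem MonoidAlgebra.conjCoeff_single {G : Type} [Group G] (g : G) (r : ℂ) :
    conjCoeff G (single g r) = single g (starRingEnd ℂ r) := by
  simp [conjCoeff]

theorem MonoidAlgebra.conjCoeff_smul {G : Type} [Group G] (r : ℂ) (x : MonoidAlgebra ℂ G) :
    conjCoeff G (r • x) = starRingEnd ℂ r • conjCoeff G x := by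
  ext g
  simp [coeff_conjCoeff]

theorem MonoidAlgebra.conjCoeff_conjSum {G : Type} [Group G] [Fintype G] (x : MonoidAlgebra ℂ G) :
    conjCoeff G (conjSum x) = conjSum (conjCoeff G x) := by
  simp [conjSum_apply, conjCoeff_single]

namespace Shape

theorem conjCoeff_youngSymmetrizer (μ : Shape n) :
    conjCoeff _ μ.youngSymmetrizer = μ.youngSymmetrizer := by
  simp [youngSymmetrizer_eq, rowSum, colSum, conjCoeff_single]

/-- `c_μ` has real coefficients, so conjugating `c_μ² = κ c_μ` and reading off the coefficient at
`1` shows that `κ` is real. -/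
theorem conj_hookProduct (μ : Shape n) : starRingEnd ℂ μ.hookProduct = μ.hookProduct := by
  have h := congrArg (conjCoeff _) μ.youngSymmetrizer_mul_self
  rw [map_mul, conjCoeff_smul, conjCoeff_youngSymmetrizer, youngSymmetrizer_mul_self] at h
  have h1 := congrArg (fun x => x.coeff 1) h
  simpa [coeff_one_youngSymmetrizer] using h1.symm

theorem conjCoeff_centralIdempotent (μ : Shape n) :
    conjCoeff _ μ.centralIdempotent = μ.centralIdempotent := by
  simp [centralIdempotent, conjCoeff_smul, conjCoeff_conjSum, conjCoeff_youngSymmetrizer,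
    conj_hookProduct]

theorem coeff_inv_centralIdempotent (μ : Shape n) (σ : Perm (Fin n)) :
    μ.centralIdempotent.coeff σ⁻¹ = μ.centralIdempotent.coeff σ := by
  have h : IsConj σ⁻¹ σ := by rw [Perm.isConj_iff_cycleType_eq, Perm.cycleType_inv]
  obtain ⟨τ, hτ⟩ := isConj_iff.1 h
  have h1 : (single τ (1 : ℂ) * μ.centralIdempotent).coeff (τ * σ⁻¹) =
      (μ.centralIdempotent * single τ 1).coeff (τ * σ⁻¹) := by
    rw [(μ.commute_centralIdempotent _).eq]
  simpa [hτ] using h1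

end Shape

theorem star_permOp (σ : Perm (Fin n)) : star (permOp σ) = permOp σ⁻¹ := by
  ext y x
  rw [Matrix.star_apply]
  have h : x = y ∘ ⇑σ⁻¹ ↔ y = x ∘ ⇑(σ⁻¹)⁻¹ := by
    rw [inv_inv]
    constructor <;> rintro rfl <;> funext i <;> simp
  simp only [permOp, Matrix.of_apply, h]
  split_ifs <;> simp

theorem star_permAlg (x : MonoidAlgebra ℂ (Perm (Fin n))) :
    star (permAlg n x) = ∑ σ, starRingEnd ℂ (x.coeff σ) • permOp σ⁻¹ := by
  conv_lhs => rw [eq_sum_coeff x]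
  simp only [map_sum, map_smul, permAlg_single, one_smul, star_sum, star_smul, star_permOp]
  rfl

theorem isStarProjection_schurProjector (μ : Shape n) : IsStarProjection (schurProjector μ) := by
  rw [schurProjector_eq]
  refine ⟨?_, ?_⟩
  · rw [IsIdempotentElem, ← map_mul, μ.centralIdempotent_mul_self]
  · rw [isSelfAdjoint_iff, star_permAlg]
    conv_rhs => rw [eq_sum_coeff μ.centralIdempotent, map_sum,
      ← Equiv.sum_comp (Equiv.inv (Perm (Fin n)))]
    refine Finset.sum_congr rfl fun σ _ => ?_
    rw [← coeff_conjCoeff, μ.conjCoeff_centralIdempotent, map_smul, permAlg_single, one_smul,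
      Equiv.inv_apply, μ.coeff_inv_centralIdempotent]

/-- Weak Schur sampling. -/
def weakSchurSampling (n : ℕ) : ProjectiveMeasurement n (Shape n) where
  proj := schurProjector
  isStarProjection := isStarProjection_schurProjector
  orthogonal μ ν h := by
    rw [schurProjector_eq, schurProjector_eq, ← map_mul, Shape.centralIdempotent_mul_of_ne h,
      map_zero]
  sum_eq_one := by
    simp only [schurProjector_eq]
    rw [← map_sum, Shape.sum_centralIdempotent, map_one]

theorem commute_permOp_schurProjector (μ : Shape n) (σ : Perm (Fin n)) :
    Commute (permOp σ) (schurProjector μ) := by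
  have h := (μ.commute_centralIdempotent (single σ 1)).map (permAlg n)
  rwa [permAlg_single, one_smul, ← schurProjector_eq] at h

theorem tensorPow_mul (U V : Matrix (Fin 2) (Fin 2) ℂ) :
    tensorPow n (U * V) = tensorPow n U * tensorPow n V := by
  ext y x
  simp only [tensorPow, Matrix.mul_apply, Matrix.of_apply]
  rw [Finset.prod_univ_sum]
  simp [Finset.prod_mul_distrib]

theorem tensorPow_one : tensorPow n 1 = 1 := by
  ext y x
  simp only [tensorPow, Matrix.one_apply, Matrix.of_apply]
  split_ifs with h
  · simp [h]
  · obtain ⟨i, hi⟩ := Function.ne_iff.1 h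
    exact Finset.prod_eq_zero (Finset.mem_univ i) (if_neg hi)

theorem star_tensorPow (U : Matrix (Fin 2) (Fin 2) ℂ) :
    star (tensorPow n U) = tensorPow n (star U) := by
  ext y x
  simp [tensorPow, Matrix.star_apply]

theorem commute_tensorPow_permOp (U : Matrix (Fin 2) (Fin 2) ℂ) (σ : Perm (Fin n)) :
    Commute (tensorPow n U) (permOp σ) := by
  ext y x
  simp only [Matrix.mul_apply, permOp, Matrix.of_apply, tensorPow]
  rw [Finset.sum_eq_single (x ∘ ⇑σ⁻¹), Finset.sum_eq_single (y ∘ ⇑σ)]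
  · rw [if_pos rfl, if_pos, mul_one, one_mul, ← Equiv.prod_comp σ]
    · simp
    · funext i; simp
  · intro z _ hz
    rw [if_neg, zero_mul]
    rintro rfl
    exact hz (by funext i; simp)
  · simp
  · intro z _ hz
    rw [if_neg hz, mul_zero]
  · simp

theorem commute_tensorPow_schurProjector (U : Matrix (Fin 2) (Fin 2) ℂ) (μ : Shape n) :
    Commute (tensorPow n U) (schurProjector μ) := by
  rw [schurProjector]
  exact (Commute.sum_right _ _ _ fun σ _ =>
    (commute_tensorPow_permOp U σ).smul_right _).smul_right _

/-- Scrambling does not change the outcome distribution. -/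
theorem outcomeProb_scrambled (x : Bits n) (U : Matrix.unitaryGroup (Fin 2) ℂ)
    (σ : Perm (Fin n)) (μ : Shape n) :
    (weakSchurSampling n).outcomeProb (scrambled x U σ) μ = (schurProjector μ x x).re := by
  set V : QubitOp n := permOp σ * tensorPow n U.1 with hV
  have hs : scrambled x U σ = V *ᵥ ket x := by rw [scrambled, Matrix.mulVec_mulVec]
  have hVV : star V * V = 1 := by
    rw [hV, star_mul, mul_assoc, ← mul_assoc (star (permOp σ)), star_permOp, ← permOp_mul,
      inv_mul_cancel, permOp_one, one_mul, star_tensorPow, ← tensorPow_mul,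
      (Matrix.mem_unitaryGroup_iff'.1 U.2), tensorPow_one]
  have hcomm : Commute V (schurProjector μ) :=
    (commute_permOp_schurProjector μ σ).mul_left (commute_tensorPow_schurProjector _ μ)
  have hvec : Matrix.vecMulVec (V *ᵥ ket x) (star (V *ᵥ ket x)) =
      V * Matrix.vecMulVec (ket x) (star (ket x)) * star V := by
    rw [Matrix.star_mulVec, Matrix.mul_vecMulVec, Matrix.vecMulVec_mul]
    rfl
  rw [ProjectiveMeasurement.outcomeProb, hs, hvec]
  change (Matrix.trace (schurProjector μ * _)).re = _
  clear_value V
  -- `P_μ` moves past `V`, and cyclicity of the trace then cancels `V` against `star V`.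
  have hP : schurProjector μ * (V * Matrix.vecMulVec (ket x) (star (ket x)) * star V) =
      V * (schurProjector μ * Matrix.vecMulVec (ket x) (star (ket x))) * star V := by
    rw [← mul_assoc, ← mul_assoc, ← hcomm.eq, mul_assoc V]
  rw [hP, Matrix.trace_mul_comm, ← mul_assoc, hVV, one_mul, Matrix.trace]
  congr 1
  rw [Finset.sum_eq_single x]
  · simp [Matrix.mul_apply, Matrix.vecMulVec_apply, ket, Pi.single_apply]
  · intro y _ hy
    simp [Matrix.mul_apply, Matrix.vecMulVec_apply, ket, Pi.single_apply, hy]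
  · simp

end Measurement

end

/-! ### Vectors annihilated by a Schur projector; ladder operators -/

noncomputable section

section Lowering

open MonoidAlgebra Equiv

variable {n : ℕ}

theorem permOp_mulVec (σ : Perm (Fin n)) (v : Bits n → ℂ) (y : Bits n) :
    (permOp σ *ᵥ v) y = v (y ∘ σ) := by
  rw [Matrix.mulVec, dotProduct, Finset.sum_eq_single (y ∘ ⇑σ)]
  · rw [permOp, Matrix.of_apply, if_pos (by funext i; simp), one_mul]
  · intro z _ hz
    rw [permOp, Matrix.of_apply, if_neg, zero_mul]
    rintro rfl
    exact hz (by funext i; simp)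
  · simp

theorem hammingNorm_comp_perm (x : Bits n) (σ : Perm (Fin n)) : hammingNorm (x ∘ σ) = hammingNorm x := by
  rw [hammingNorm, hammingNorm]
  refine Finset.card_bij (fun i _ => σ i) (by simp) (by simp) (fun i hi => ⟨σ⁻¹ i, ?_, by simp⟩)
  simpa using hi

theorem permAlg_mul_mulVec (x y : MonoidAlgebra ℂ (Perm (Fin n))) (v : Bits n → ℂ) :
    permAlg n (x * y) *ᵥ v = permAlg n x *ᵥ (permAlg n y *ᵥ v) := by
  rw [map_mul, Matrix.mulVec_mulVec]

/-- Each summand `g x y g⁻¹` applies `y` to a permuted copy of `v`. -/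
theorem permAlg_conjSum_mulVec_eq_zero (x y : MonoidAlgebra ℂ (Perm (Fin n))) (v : Bits n → ℂ)
    (h : ∀ σ, permAlg n y *ᵥ (permOp σ *ᵥ v) = 0) : permAlg n (conjSum (x * y)) *ᵥ v = 0 := by
  rw [conjSum_apply, map_sum, Matrix.sum_mulVec]
  refine Finset.sum_eq_zero fun σ _ => ?_
  rw [permAlg_mul_mulVec, permAlg_mul_mulVec, permAlg_mul_mulVec, permAlg_single σ⁻¹, one_smul, h,
    Matrix.mulVec_zero, Matrix.mulVec_zero]

theorem schurProjector_mulVec_eq_zero_of_colSum (μ : Shape n) (v : Bits n → ℂ)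
    (h : ∀ σ, permAlg n μ.colSum *ᵥ (permOp σ *ᵥ v) = 0) : schurProjector μ *ᵥ v = 0 := by
  rw [schurProjector_eq, Shape.centralIdempotent, map_smul, Matrix.smul_mulVec,
    μ.youngSymmetrizer_eq, permAlg_conjSum_mulVec_eq_zero _ _ _ h, smul_zero]

theorem schurProjector_mulVec_eq_zero_of_rowSum (μ : Shape n) (v : Bits n → ℂ)
    (h : ∀ σ, permAlg n μ.rowSum *ᵥ (permOp σ *ᵥ v) = 0) : schurProjector μ *ᵥ v = 0 := by
  rw [schurProjector_eq, Shape.centralIdempotent, map_smul, Matrix.smul_mulVec,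
    ← μ.conjSum_colSum_mul_rowSum, permAlg_conjSum_mulVec_eq_zero _ _ _ h, smul_zero]

/-- The column antisymmetrizer kills basis states with equal bits in a column. -/
theorem permAlg_colSum_apply_eq_zero (μ : Shape n) (x y : Bits n) {i j : Fin n} (hij : i ≠ j)
    (hc : μ.col i = μ.col j) (hx : x i = x j) : permAlg n μ.colSum y x = 0 := by
  -- The transposition fixes `|x⟩` but changes the sign of the antisymmetrizer.
  have h1 : permAlg n μ.colSum * permOp (swap i j) = -permAlg n μ.colSum := by
    have := congrArg (permAlg n) (μ.colSum_mul_single (μ.swap_mem_colStabilizer hc))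
    rwa [map_mul, permAlg_single, one_smul, Perm.sign_swap hij, map_smul, Units.val_neg,
      Units.val_one, Int.cast_neg, Int.cast_one, neg_one_smul] at this
  have h2 := congrFun (congrFun h1 y) x
  rw [Matrix.mul_apply, Finset.sum_eq_single x, Matrix.neg_apply] at h2
  · have h3 : permOp (swap i j) x x = 1 := by
      rw [permOp, Matrix.of_apply, if_pos]
      funext k
      rw [Function.comp_apply, swap_inv, swap_apply_def]
      split_ifs with h4 h5
      · rw [h4, hx]
      · rw [h5, hx]
      · rfl
    rw [h3, mul_one] at h2
    exact eq_zero_of_eq_neg_self h2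
  · intro z _ hz
    have h3 : permOp (swap i j) z x = 0 := by
      rw [permOp, Matrix.of_apply, if_neg]
      rintro rfl
      refine hz ?_
      funext k
      rw [Function.comp_apply, swap_inv, swap_apply_def]
      split_ifs with h4 h5
      · rw [h4, hx]
      · rw [h5, hx]
      · rfl
    rw [h3, mul_zero]
  · simp

theorem schurProjector_mulVec_eq_zero_of_col (μ : Shape n) (v : Bits n → ℂ)
    (h : ∀ (x : Bits n) (σ : Perm (Fin n)), v (x ∘ ⇑σ) ≠ 0 → ∃ i j, i ≠ j ∧ μ.col i = μ.col j ∧ x i = x j) :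
    schurProjector μ *ᵥ v = 0 := by
  refine schurProjector_mulVec_eq_zero_of_colSum μ v fun σ => funext fun y => ?_
  rw [Matrix.mulVec, dotProduct]
  refine Finset.sum_eq_zero fun x _ => ?_
  by_cases hx : v (x ∘ ⇑σ) = 0
  · rw [permOp_mulVec, hx, mul_zero]
  · obtain ⟨i, j, h1, h2, h3⟩ := h x σ hx
    rw [permAlg_colSum_apply_eq_zero μ x y h1 h2 h3, zero_mul]

/-- Pigeonhole: three boxes of the first column carry only two bit values. -/
theorem schurProjector_mulVec_eq_zero_of_three_rows (μ : Shape n) (hμ : (2, 0) ∈ μ.1)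
    (v : Bits n → ℂ) : schurProjector μ *ᵥ v = 0 := by
  refine schurProjector_mulVec_eq_zero_of_col μ v fun x _ _ => ?_
  obtain ⟨a, ha, ha'⟩ := μ.exists_row_col (μ.1.up_left_mem (Nat.zero_le 2) le_rfl hμ)
  obtain ⟨b, hb, hb'⟩ := μ.exists_row_col (μ.1.up_left_mem one_le_two le_rfl hμ)
  obtain ⟨c, hc, hc'⟩ := μ.exists_row_col hμ
  have hab : a ≠ b := by rintro rfl; omega
  have hac : a ≠ c := by rintro rfl; omega
  have hbc : b ≠ c := by rintro rfl; omega
  by_cases h1 : x a = x b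
  · exact ⟨a, b, hab, ha'.trans hb'.symm, h1⟩
  by_cases h2 : x a = x c
  · exact ⟨a, c, hac, ha'.trans hc'.symm, h2⟩
  · exact ⟨b, c, hbc, hb'.trans hc'.symm, by omega⟩

/-- The first two boxes of each of the `rowLen 1` leading columns would otherwise carry different
bits, each such column contributing a `1`. -/
theorem Shape.exists_col_eq_of_hammingNorm_lt (μ : Shape n) (x : Bits n)
    (hx : hammingNorm x < μ.1.rowLen 1) : ∃ i j, i ≠ j ∧ μ.col i = μ.col j ∧ x i = x j := by
  by_contra! hcon
  have h1 : ∀ c ∈ Finset.range (μ.1.rowLen 1), ∃ i, x i ≠ 0 ∧ μ.col i = c := by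
    intro c hc
    have hmem : (1, c) ∈ μ.1 := YoungDiagram.mem_iff_lt_rowLen.2 (Finset.mem_range.1 hc)
    obtain ⟨a, ha, ha'⟩ := μ.exists_row_col (μ.1.up_left_mem (Nat.zero_le 1) le_rfl hmem)
    obtain ⟨b, hb, hb'⟩ := μ.exists_row_col hmem
    have hab : a ≠ b := by rintro rfl; omega
    by_cases h0 : x a = 0
    · refine ⟨b, fun h => hcon a b hab (ha'.trans hb'.symm) (h0.trans h.symm), hb'⟩
    · exact ⟨a, h0, ha'⟩
  refine absurd hx (not_lt.2 ?_)
  calc μ.1.rowLen 1 = (Finset.range (μ.1.rowLen 1)).card := (Finset.card_range _).symm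
    _ ≤ ((Finset.univ.filter fun i => x i ≠ 0).image μ.col).card := by
        refine Finset.card_le_card fun c hc => ?_
        obtain ⟨i, hi, hi'⟩ := h1 c hc
        exact Finset.mem_image.2 ⟨i, by simpa using hi, hi'⟩
    _ ≤ _ := Finset.card_image_le

theorem schurProjector_mulVec_eq_zero_of_hammingNorm_lt (μ : Shape n) (v : Bits n → ℂ) {k : ℕ}
    (hv : ∀ x, v x ≠ 0 → hammingNorm x = k) (hk : k < μ.1.rowLen 1) :
    schurProjector μ *ᵥ v = 0 :=
  schurProjector_mulVec_eq_zero_of_col μ v fun x σ hx =>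
    μ.exists_col_eq_of_hammingNorm_lt x (by rw [← hammingNorm_comp_perm x σ, hv _ hx]; exact hk)

/-! ### Raising and lowering operators -/

/-- The operator that adds up the ways of turning a `1` into a `0`. -/
def lowering (n : ℕ) : QubitOp n :=
  Matrix.of fun z y => ∑ i with z i = 0, if y = Function.update z i 1 then 1 else 0

/-- The operator that adds up the ways of turning a `0` into a `1`. -/
def raising (n : ℕ) : QubitOp n :=
  Matrix.of fun y z => ∑ i with y i = 1, if z = Function.update y i 0 then 1 else 0

theorem lowering_mulVec (v : Bits n → ℂ) (z : Bits n) :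
    (lowering n *ᵥ v) z = ∑ i with z i = 0, v (Function.update z i 1) := by
  simp only [Matrix.mulVec, dotProduct, lowering, Matrix.of_apply, Finset.sum_mul, ite_mul,
    one_mul, zero_mul]
  rw [Finset.sum_comm]
  simp

theorem raising_mulVec (v : Bits n → ℂ) (y : Bits n) :
    (raising n *ᵥ v) y = ∑ i with y i = 1, v (Function.update y i 0) := by
  simp only [Matrix.mulVec, dotProduct, raising, Matrix.of_apply, Finset.sum_mul, ite_mul,
    one_mul, zero_mul]
  rw [Finset.sum_comm]
  simp

theorem star_lowering : star (lowering n) = raising n := by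
  ext y z
  simp only [Matrix.star_apply, lowering, raising, Matrix.of_apply, star_sum, apply_ite star,
    star_one, star_zero, Finset.sum_filter]
  refine Finset.sum_congr rfl fun i _ => ?_
  by_cases h : y i = 1 ∧ z = Function.update y i 0
  · obtain ⟨h1, rfl⟩ := h
    simp [← h1]
  · have h' : ¬ (z i = 0 ∧ y = Function.update z i 1) := by
      rintro ⟨h1, rfl⟩
      exact h (by simp [← h1])
    rw [← ite_and, ← ite_and, if_neg h, if_neg h']

theorem lowering_permOp_mulVec (σ : Perm (Fin n)) (v : Bits n → ℂ) :
    lowering n *ᵥ (permOp σ *ᵥ v) = permOp σ *ᵥ (lowering n *ᵥ v) := by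
  funext z
  rw [permOp_mulVec, lowering_mulVec, lowering_mulVec]
  symm
  refine Finset.sum_bij (fun i _ => σ i) (by simp) (by simp)
    (fun i hi => ⟨σ⁻¹ i, by simpa using hi, by simp⟩) (fun i _ => ?_)
  rw [permOp_mulVec]
  congr 1
  funext j
  by_cases h : j = i
  · simp [h]
  · simp [Function.update_of_ne h, Function.update_of_ne (σ.injective.ne h)]

theorem commute_lowering_permOp (σ : Perm (Fin n)) : Commute (lowering n) (permOp σ) := by
  refine Matrix.mulVec_injective (funext fun v => ?_)
  rw [← Matrix.mulVec_mulVec, ← Matrix.mulVec_mulVec, lowering_permOp_mulVec]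

theorem commute_lowering_permAlg (x : MonoidAlgebra ℂ (Perm (Fin n))) :
    Commute (lowering n) (permAlg n x) := by
  rw [eq_sum_coeff x, map_sum]
  refine Commute.sum_right _ _ _ fun σ _ => ?_
  rw [map_smul, permAlg_single, one_smul]
  exact (commute_lowering_permOp σ).smul_right _

theorem commute_lowering_schurProjector (μ : Shape n) :
    Commute (lowering n) (schurProjector μ) := by
  rw [schurProjector_eq]
  exact commute_lowering_permAlg _

theorem commute_raising_schurProjector (μ : Shape n) :
    Commute (raising n) (schurProjector μ) := by
  have h := (commute_lowering_schurProjector μ).star_star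
  rwa [star_lowering, (isStarProjection_schurProjector μ).isSelfAdjoint.star_eq] at h

end Lowering

end

/-! ### Weight spaces, the `sl₂` relation, and lowest-weight vectors -/

noncomputable section

section Weight

open MonoidAlgebra Equiv

variable {n : ℕ}

/-- The projection onto the span of the basis states of Hamming weight `k`. -/
def weightProj (n k : ℕ) : QubitOp n :=
  Matrix.diagonal fun x => if hammingNorm x = k then 1 else 0

theorem weightProj_mulVec (k : ℕ) (v : Bits n → ℂ) (x : Bits n) :
    (weightProj n k *ᵥ v) x = if hammingNorm x = k then v x else 0 := by
  rw [weightProj, Matrix.mulVec_diagonal]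
  split_ifs <;> simp

theorem weightProj_mulVec_eq_self_iff (k : ℕ) (v : Bits n → ℂ) :
    weightProj n k *ᵥ v = v ↔ ∀ x, v x ≠ 0 → hammingNorm x = k := by
  simp only [funext_iff, weightProj_mulVec]
  refine forall_congr' fun x => ?_
  by_cases h : hammingNorm x = k <;> simp [h, eq_comm]

theorem weightProj_mul_self (k : ℕ) : weightProj n k * weightProj n k = weightProj n k := by
  rw [weightProj, Matrix.diagonal_mul_diagonal]
  congr 1
  funext x
  split_ifs <;> simp

theorem star_weightProj (k : ℕ) : star (weightProj n k) = weightProj n k := by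
  rw [weightProj, Matrix.star_eq_conjTranspose, Matrix.diagonal_conjTranspose]
  congr 1
  funext x
  rw [Pi.star_apply]
  split_ifs <;> simp

theorem commute_weightProj_permOp (k : ℕ) (σ : Perm (Fin n)) :
    Commute (weightProj n k) (permOp σ) := by
  refine Matrix.mulVec_injective (funext fun v => ?_)
  rw [← Matrix.mulVec_mulVec, ← Matrix.mulVec_mulVec]
  funext x
  rw [weightProj_mulVec, permOp_mulVec, permOp_mulVec, weightProj_mulVec, hammingNorm_comp_perm]

theorem commute_weightProj_permAlg (k : ℕ) (x : MonoidAlgebra ℂ (Perm (Fin n))) :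
    Commute (weightProj n k) (permAlg n x) := by
  rw [eq_sum_coeff x, map_sum]
  refine Commute.sum_right _ _ _ fun σ _ => ?_
  rw [map_smul, permAlg_single, one_smul]
  exact (commute_weightProj_permOp k σ).smul_right _

theorem hammingNorm_update_one {z : Bits n} {i : Fin n} (h : z i = 0) :
    hammingNorm (Function.update z i 1) = hammingNorm z + 1 := by
  rw [hammingNorm, hammingNorm, ← Finset.card_insert_of_notMem (a := i) (by simpa using h)]
  congr 1
  ext j
  by_cases hj : j = i
  · simp [hj]
  · simp [hj]

theorem lowering_mul_weightProj (k : ℕ) :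
    lowering n * weightProj n (k + 1) = weightProj n k * lowering n := by
  refine Matrix.mulVec_injective (funext fun v => ?_)
  rw [← Matrix.mulVec_mulVec, ← Matrix.mulVec_mulVec]
  funext z
  rw [weightProj_mulVec, lowering_mulVec, lowering_mulVec]
  split_ifs with hz
  · refine Finset.sum_congr rfl fun i hi => ?_
    rw [weightProj_mulVec, hammingNorm_update_one (by simpa using hi), hz, if_pos rfl]
  · refine Finset.sum_eq_zero fun i hi => ?_
    rw [weightProj_mulVec, hammingNorm_update_one (by simpa using hi), if_neg (by omega)]

theorem weightProj_mul_raising (k : ℕ) :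
    weightProj n (k + 1) * raising n = raising n * weightProj n k := by
  have h := congrArg star (lowering_mul_weightProj (n := n) k)
  rwa [star_mul, star_mul, star_weightProj, star_weightProj, star_lowering] at h

/-- Changing a `0` at `i` and a `1` at `l` commute for `i ≠ l`. What remains are the flips undone at
the same place: `n - |z|` in one order and `|z|` in the other. -/
theorem lowering_raising_mulVec (v : Bits n → ℂ) (z : Bits n) :
    (lowering n *ᵥ (raising n *ᵥ v)) z =
      (raising n *ᵥ (lowering n *ᵥ v)) z + ((n : ℂ) - 2 * hammingNorm z) * v z := by
  have h1 : ∀ i, z i = 0 → (raising n *ᵥ v) (Function.update z i 1) =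
      v z + ∑ l with z l = 1, v (Function.update (Function.update z i 1) l 0) := by
    intro i hi
    rw [raising_mulVec]
    have : (Finset.univ.filter fun l => Function.update z i 1 l = 1) =
        insert i (Finset.univ.filter fun l => z l = 1) := by
      ext l
      by_cases hl : l = i <;> simp [hl]
    rw [this, Finset.sum_insert (by simp [hi]), Function.update_idem, ← hi,
      Function.update_eq_self]
  have h2 : ∀ l, z l = 1 → (lowering n *ᵥ v) (Function.update z l 0) =
      v z + ∑ i with z i = 0, v (Function.update (Function.update z l 0) i 1) := by
    intro l hl
    rw [lowering_mulVec]
    have : (Finset.univ.filter fun i => Function.update z l 0 i = 0) =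
        insert l (Finset.univ.filter fun i => z i = 0) := by
      ext i
      by_cases hi : i = l <;> simp [hi]
    rw [this, Finset.sum_insert (by simp [hl]), Function.update_idem, ← hl,
      Function.update_eq_self]
  rw [lowering_mulVec, raising_mulVec,
    Finset.sum_congr rfl fun i hi => h1 i (Finset.mem_filter.1 hi).2,
    Finset.sum_congr rfl fun l hl => h2 l (Finset.mem_filter.1 hl).2,
    Finset.sum_add_distrib, Finset.sum_add_distrib, Finset.sum_comm]
  have h3 : ∀ l ∈ Finset.univ.filter fun l => z l = 1, ∀ i ∈ Finset.univ.filter fun i => z i = 0,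
      v (Function.update (Function.update z i 1) l 0) =
        v (Function.update (Function.update z l 0) i 1) := by
    intro l hl i hi
    rw [Function.update_comm]
    rintro rfl
    have h4 := (Finset.mem_filter.1 hl).2
    have h5 := (Finset.mem_filter.1 hi).2
    simp [h4] at h5
  rw [Finset.sum_congr rfl fun l hl => Finset.sum_congr rfl (h3 l hl)]
  have h6 : (Finset.univ.filter fun l => z l = 1).card = hammingNorm z := by
    rw [hammingNorm]
    congr 1
    ext l
    have : ∀ b : Fin 2, b = 1 ↔ b ≠ 0 := by decide
    simp [this]
  have h7 : ((Finset.univ.filter fun l => z l = 0).card : ℂ) = n - hammingNorm z := by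
    have := Finset.card_filter_add_card_filter_not (s := (Finset.univ : Finset (Fin n)))
      (fun l => z l = 0)
    rw [Finset.card_univ, Fintype.card_fin] at this
    rw [hammingNorm, eq_sub_iff_add_eq]
    exact_mod_cast this
  rw [Finset.sum_const, Finset.sum_const, h6, nsmul_eq_mul, nsmul_eq_mul, h7]
  ring

/-- A vector of weight more than the number of boxes below the first row, killed by the lowering
operator and fixed by the row permutations, is zero. -/
theorem eq_zero_of_lowering_of_row_invariant (μ : Shape n) (v : Bits n → ℂ) {k : ℕ}
    (hinv : ∀ p ∈ μ.rowStabilizer, permOp p *ᵥ v = v) (hv : ∀ x, v x ≠ 0 → hammingNorm x = k)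
    (hL : lowering n *ᵥ v = 0) (hk : (Finset.univ.filter fun i => μ.row i ≠ 0).card < k) :
    v = 0 := by
  -- Induction on the number of zeros of `y` below the first row.
  have key : ∀ s (y : Bits n), hammingNorm y = k →
      (Finset.univ.filter fun i => μ.row i ≠ 0 ∧ y i = 0).card = s → v y = 0 := by
    intro s
    induction s using Nat.strong_induction_on with
    | _ s ih =>
      intro y hy hs
      -- The weight exceeds the number of boxes below the first row, so some `1` lies in that row.
      have hi₀ : ∃ i₀, μ.row i₀ = 0 ∧ y i₀ ≠ 0 := by
        by_contra! hcon
        refine absurd hk (not_lt.2 ?_)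
        rw [← hy, hammingNorm]
        refine Finset.card_le_card fun i hi => ?_
        simp only [Finset.mem_filter, Finset.mem_univ, true_and] at hi ⊢
        exact fun h => hi (hcon i h)
      obtain ⟨i₀, hr, hy0⟩ := hi₀
      have hy1 : y i₀ = 1 := by omega
      -- With this `1` erased, the equation `L v = 0` sums `v` over all ways to put it back. Places
      -- in the first row all give `v y` by row invariance; places below it leave fewer zeros there
      -- and give `0` by induction. The place `i₀` itself makes the multiplicity of `v y` positive.
      have hz := congrFun hL (Function.update y i₀ 0)
      rw [lowering_mulVec, Pi.zero_apply] at hz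
      have hswap : ∀ i ∈ Finset.univ.filter fun i => Function.update y i₀ 0 i = 0,
          v (Function.update (Function.update y i₀ 0) i 1) = if μ.row i = 0 then v y else 0 := by
        intro i hi
        have hi' : Function.update y i₀ 0 i = 0 := (Finset.mem_filter.1 hi).2
        have he : Function.update (Function.update y i₀ 0) i 1 = y ∘ swap i i₀ := by
          funext j
          rw [Function.comp_apply, swap_apply_def]
          split_ifs with h1 h2
          · rw [h1, Function.update_self, hy1]
          · rw [Function.update_of_ne h1, h2, Function.update_self]
            rw [Function.update_of_ne (by rintro rfl; exact h1 h2)] at hi'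
            exact hi'.symm
          · rw [Function.update_of_ne h1, Function.update_of_ne h2]
        rw [he]
        split_ifs with hrow
        · have h := congrFun (hinv _ (μ.swap_mem_rowStabilizer (hrow.trans hr.symm))) y
          rwa [permOp_mulVec] at h
        · have hne : i ≠ i₀ := by rintro rfl; exact hrow hr
          rw [Function.update_of_ne hne] at hi'
          refine ih _ ?_ _ ((hammingNorm_comp_perm y _).trans hy) rfl
          rw [← hs]
          refine Finset.card_lt_card (Finset.ssubset_iff_of_subset (fun j hj => ?_) |>.2
            ⟨i, by simp [hrow, hi'], by simp [hy1]⟩)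
          simp only [Finset.mem_filter, Finset.mem_univ, true_and, Function.comp_apply] at hj ⊢
          refine ⟨hj.1, ?_⟩
          have h1 : j ≠ i₀ := by rintro rfl; exact hj.1 hr
          have h2 : j ≠ i := by
            rintro rfl
            simp [hy1] at hj
          simpa [swap_apply_of_ne_of_ne h2 h1] using hj.2
      rw [Finset.sum_congr rfl hswap, ← Finset.sum_filter, Finset.sum_const, smul_eq_zero] at hz
      refine hz.resolve_left ?_
      rw [Finset.card_eq_zero, ← ne_eq, ← Finset.nonempty_iff_ne_empty]
      exact ⟨i₀, by simp [hr]⟩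
  funext y
  by_contra hy
  exact hy (key _ y (hv y hy) rfl)

theorem Shape.card_row_ne_zero (μ : Shape n) (hμ : (2, 0) ∉ μ.1) :
    (Finset.univ.filter fun i => μ.row i ≠ 0).card = μ.1.rowLen 1 := by
  rw [← μ.card_row_eq 1]
  congr 1
  ext i
  simp only [Finset.mem_filter, Finset.mem_univ, true_and]
  have : ¬ 2 ≤ μ.row i := fun h => hμ (μ.1.up_left_mem h (Nat.zero_le _) (μ.row_col_mem i))
  omega

/-- Row symmetrization commutes with `L` and with the weight, so it yields a row-invariant vector of
weight `k` in `ker L`. -/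
theorem schurProjector_mulVec_eq_zero_of_lowering (μ : Shape n) (v : Bits n → ℂ) {k : ℕ}
    (hv : weightProj n k *ᵥ v = v) (hL : lowering n *ᵥ v = 0) (hk : μ.1.rowLen 1 < k) :
    schurProjector μ *ᵥ v = 0 := by
  by_cases hμ : (2, 0) ∈ μ.1
  · exact schurProjector_mulVec_eq_zero_of_three_rows μ hμ v
  refine schurProjector_mulVec_eq_zero_of_rowSum μ v fun σ => ?_
  have hcomm : permAlg n μ.rowSum *ᵥ (permOp σ *ᵥ v) =
      permAlg n (μ.rowSum * single σ 1) *ᵥ v := by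
    rw [permAlg_mul_mulVec, permAlg_single, one_smul]
  refine eq_zero_of_lowering_of_row_invariant (k := k) μ _ (fun p hp => ?_) ?_ ?_
    (by rwa [μ.card_row_ne_zero hμ])
  · have h := congrArg (permAlg n) (μ.single_mul_rowSum hp)
    rw [map_mul, permAlg_single, one_smul] at h
    rw [Matrix.mulVec_mulVec, h]
  · rw [hcomm, ← weightProj_mulVec_eq_self_iff, Matrix.mulVec_mulVec,
      (commute_weightProj_permAlg k _).eq, ← Matrix.mulVec_mulVec, hv]
  · rw [hcomm, Matrix.mulVec_mulVec, (commute_lowering_permAlg _).eq, ← Matrix.mulVec_mulVec, hL,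
      Matrix.mulVec_zero]

end Weight

end

/-! ### The trace of the guess projector on a weight space, and the success probability -/

noncomputable section

section Guess

open MonoidAlgebra Equiv

variable {n : ℕ}

/-- The projection onto the outcomes whose guess is `k`. -/
def guessProj (n k : ℕ) : QubitOp n := ∑ μ : Shape n with guess μ = k, schurProjector μ

/-- The projection onto the outcomes whose guess is not `k`. -/
def missProj (n k : ℕ) : QubitOp n := ∑ μ : Shape n with guess μ ≠ k, schurProjector μ

theorem guessProj_add_missProj (k : ℕ) : guessProj n k + missProj n k = 1 := by
  rw [guessProj, missProj, Finset.sum_filter_add_sum_filter_not]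
  exact (weakSchurSampling n).sum_eq_one

theorem commute_guessProj {A : QubitOp n} (h : ∀ μ, Commute A (schurProjector μ)) (k : ℕ) :
    Commute A (guessProj n k) :=
  Commute.sum_right _ _ _ fun μ _ => h μ

theorem guessProj_mulVec_eq_zero {k m : ℕ} (hm : m < k) (v : Bits n → ℂ)
    (hv : weightProj n m *ᵥ v = v) : guessProj n k *ᵥ v = 0 := by
  rw [guessProj, Matrix.sum_mulVec]
  refine Finset.sum_eq_zero fun μ hμ => ?_
  refine schurProjector_mulVec_eq_zero_of_hammingNorm_lt μ v
    ((weightProj_mulVec_eq_self_iff _ _).1 hv) ?_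
  rw [← (Finset.mem_filter.1 hμ).2] at hm
  exact hm

theorem missProj_mulVec_eq_zero {k : ℕ} (v : Bits n → ℂ)
    (hv : weightProj n k *ᵥ v = v) (hL : lowering n *ᵥ v = 0) : missProj n k *ᵥ v = 0 := by
  rw [missProj, Matrix.sum_mulVec]
  refine Finset.sum_eq_zero fun μ hμ => ?_
  rcases lt_or_gt_of_ne (Finset.mem_filter.1 hμ).2 with h | h
  · exact schurProjector_mulVec_eq_zero_of_lowering μ v hv hL h
  · exact schurProjector_mulVec_eq_zero_of_hammingNorm_lt μ v
      ((weightProj_mulVec_eq_self_iff _ _).1 hv) h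

open scoped ComplexOrder in
/-- The raising operator is injective below the middle weight. -/
theorem eq_zero_of_raising {m : ℕ} (hm : 2 * m < n) (v : Bits n → ℂ)
    (hv : weightProj n m *ᵥ v = v) (hR : raising n *ᵥ v = 0) : v = 0 := by
  have hdiag : ∀ z, ((n : ℂ) - 2 * hammingNorm z) * v z = ((n : ℂ) - 2 * m) * v z := by
    intro z
    by_cases hz : v z = 0
    · rw [hz, mul_zero, mul_zero]
    · rw [(weightProj_mulVec_eq_self_iff _ _).1 hv z hz]
  -- Pairing with `v` gives `‖L v‖² + (n - 2m) ‖v‖² = 0`, where both terms are nonnegative.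
  have h1 : raising n *ᵥ (lowering n *ᵥ v) + ((n : ℂ) - 2 * m) • v = 0 := by
    funext z
    have := lowering_raising_mulVec v z
    rw [hR, Matrix.mulVec_zero, hdiag] at this
    exact this.symm
  have h2 : star v ⬝ᵥ (raising n *ᵥ (lowering n *ᵥ v)) =
      star (lowering n *ᵥ v) ⬝ᵥ (lowering n *ᵥ v) := by
    rw [Matrix.dotProduct_mulVec, Matrix.star_mulVec, ← Matrix.star_eq_conjTranspose, star_lowering]
  have h3 : star (lowering n *ᵥ v) ⬝ᵥ (lowering n *ᵥ v) + ((n : ℂ) - 2 * m) * (star v ⬝ᵥ v) = 0 := by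
    rw [← h2, ← smul_eq_mul, ← dotProduct_smul, ← dotProduct_add, h1, dotProduct_zero]
  have h4 : (0 : ℂ) ≤ star (lowering n *ᵥ v) ⬝ᵥ (lowering n *ᵥ v) := dotProduct_star_self_nonneg _
  have h5 : (0 : ℂ) ≤ star v ⬝ᵥ v := dotProduct_star_self_nonneg _
  have h6 : (0 : ℂ) < (n : ℂ) - 2 * m := by
    rw [sub_pos]
    exact_mod_cast hm
  have h7 := (add_eq_zero_iff_of_nonneg h4 (mul_nonneg h6.le h5)).1 h3
  have h8 := (mul_eq_zero.1 h7.2).resolve_left h6.ne'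
  exact dotProduct_star_self_eq_zero.1 h8

open scoped ComplexOrder in
-- `P L R P` is the Gram operator of `R` on weight `m`, invertible there since `R` is injective; the
-- summand `1 - P` extends it invertibly to the whole space.
theorem isUnit_lowering_mul_raising {m : ℕ} (hm : 2 * m < n) :
    IsUnit (weightProj n m * lowering n * (raising n * weightProj n m) + (1 - weightProj n m)) := by
  set P := weightProj n m with hP
  have hPP : P * P = P := weightProj_mul_self m
  rw [← Matrix.mulVec_injective_iff_isUnit]
  refine (injective_iff_map_eq_zero (Matrix.mulVecLin _)).2 fun v hv => ?_
  rw [Matrix.mulVecLin_apply] at hv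
  have h1 : (1 - P) *ᵥ v = 0 := by
    have hz : (1 - P) * P = 0 := by rw [sub_mul, one_mul, hPP, sub_self]
    have he : (1 - P) * (P * lowering n * (raising n * P) + (1 - P)) = 1 - P := by
      rw [mul_add, mul_assoc P, ← mul_assoc (1 - P) P, hz, zero_mul, zero_add, mul_sub, mul_one, hz,
        sub_zero]
    rw [← he, ← Matrix.mulVec_mulVec, hv, Matrix.mulVec_zero]
  have h2 : P *ᵥ v = v := by
    rw [Matrix.sub_mulVec, Matrix.one_mulVec, sub_eq_zero] at h1
    exact h1.symm
  refine eq_zero_of_raising hm v h2 ?_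
  rw [Matrix.add_mulVec, h1, add_zero, ← Matrix.mulVec_mulVec, 
    ← Matrix.mulVec_mulVec v (raising n), h2] at hv
  have h3 : star (raising n *ᵥ v) ⬝ᵥ (raising n *ᵥ v) = 0 := by
    have h4 : star v ᵥ* (P * lowering n) = star (raising n *ᵥ v) := by
      conv_rhs => rw [← h2]
      rw [Matrix.star_mulVec, Matrix.star_mulVec, Matrix.vecMul_vecMul,
        ← Matrix.star_eq_conjTranspose, ← Matrix.star_eq_conjTranspose, star_weightProj,
        ← star_lowering, star_star]
    rw [← h4, ← Matrix.dotProduct_mulVec, hv, dotProduct_zero]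
  exact dotProduct_star_self_eq_zero.1 h3

theorem trace_weightProj (k : ℕ) :
    (weightProj n k).trace = ((Finset.univ.filter fun x : Bits n => hammingNorm x = k).card : ℂ) := by
  rw [weightProj, Matrix.trace_diagonal, Finset.sum_boole]

theorem trace_guessProj_mul_weightProj {m : ℕ} (hm : 2 * m < n) :
    (guessProj n (m + 1) * weightProj n (m + 1)).trace =
      (weightProj n (m + 1)).trace - (weightProj n m).trace := by
  set P := weightProj n m
  set P' := weightProj n (m + 1)
  set L := lowering n
  set R := raising n
  set Q := guessProj n (m + 1)
  set S := missProj n (m + 1)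
  have hQS : Q + S = 1 := guessProj_add_missProj _
  have hPP : P * P = P := weightProj_mul_self m
  have hPP' : P' * P' = P' := weightProj_mul_self (m + 1)
  have hLP : L * P' = P * L := lowering_mul_weightProj m
  have hRP : P' * R = R * P := weightProj_mul_raising m
  have hQR : Commute R Q := commute_guessProj commute_raising_schurProjector _
  obtain ⟨u, hu'⟩ := isUnit_lowering_mul_raising hm
  set N : QubitOp n := ↑u
  set N' : QubitOp n := ↑u⁻¹
  have hu : N = P * L * (R * P) + (1 - P) := hu'
  have hNN' : N * N' = 1 := u.mul_inv
  have hPN : P * N = P * L * (R * P) := by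
    rw [hu, mul_add, mul_sub, mul_one, hPP, sub_self, add_zero]
    simp only [← mul_assoc, hPP]
  -- On weight `m + 1`, `E` is the projection onto the image of `R` along `ker L`. The guess
  -- projector `Q` kills that image and `S = 1 - Q` kills that kernel, so `Q P' = P' - E`; by
  -- cyclicity `E` and `P` have the same trace.
  set E := R * P * N' * (P * L) with hE
  have hQP : Q * P = 0 := by
    refine Matrix.mulVec_injective (funext fun v => ?_)
    rw [← Matrix.mulVec_mulVec, Matrix.zero_mulVec]
    exact guessProj_mulVec_eq_zero (Nat.lt_succ_self m) _ (by rw [Matrix.mulVec_mulVec, hPP])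
  have hQE : Q * E = 0 := by
    have h : Q * (R * P) = 0 := by rw [← mul_assoc, ← hQR.eq, mul_assoc, hQP, mul_zero]
    rw [hE, mul_assoc (R * P), ← mul_assoc, h, zero_mul]
  have hPE : P' * E = E := by
    have h : P' * (R * P) = R * P := by rw [← mul_assoc, hRP, mul_assoc, hPP]
    rw [hE, mul_assoc (R * P), ← mul_assoc, h]
  have hLE : P * L * E = P * L := by
    calc P * L * E = P * L * (R * P) * N' * (P * L) := by rw [hE]; simp only [mul_assoc]
      _ = P * (P * L) := by rw [← hPN, mul_assoc P, hNN', mul_one]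
      _ = P * L := by rw [← mul_assoc, hPP]
  have hS : S * (P' * (1 - E)) = 0 := by
    refine Matrix.mulVec_injective (funext fun v => ?_)
    rw [← Matrix.mulVec_mulVec, Matrix.zero_mulVec]
    refine missProj_mulVec_eq_zero _ ?_ ?_
    · rw [Matrix.mulVec_mulVec, ← mul_assoc, hPP']
    · change L *ᵥ _ = 0
      rw [Matrix.mulVec_mulVec, ← mul_assoc, hLP, mul_sub, mul_one, hLE, sub_self,
        Matrix.zero_mulVec]
  have hSQ : S = 1 - Q := eq_sub_of_add_eq' hQS
  have hSE : S * E = E := by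
    rw [hSQ, sub_mul, one_mul, hQE, sub_zero]
  have hSP : S * P' = E := by
    rw [mul_sub, mul_one, hPE, mul_sub, hSE, sub_eq_zero] at hS
    exact hS
  have hQP' : Q * P' = P' - E := by
    rw [← hSP, hSQ, sub_mul, one_mul, sub_sub_cancel]
  have htr : E.trace = P.trace := by
    calc E.trace = (P * L * (R * P * N')).trace := Matrix.trace_mul_comm _ _
      _ = (P * L * (R * P) * N').trace := by simp only [mul_assoc]
      _ = P.trace := by rw [← hPN, mul_assoc, hNN', mul_one]
  rw [hQP', Matrix.trace_sub, htr]

theorem card_hammingNorm_eq (n k : ℕ) :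
    (Finset.univ.filter fun x : Bits n => hammingNorm x = k).card = n.choose k := by
  have h : n.choose k = (Finset.powersetCard k (Finset.univ : Finset (Fin n))).card := by
    rw [Finset.card_powersetCard, Finset.card_univ, Fintype.card_fin]
  rw [h]
  refine Finset.card_nbij' (fun x => Finset.univ.filter fun i => x i ≠ 0)
    (fun s i => if i ∈ s then 1 else 0) ?_ ?_ ?_ ?_
  · intro x hx
    simpa [Finset.mem_powersetCard, hammingNorm] using hx
  · intro s hs
    simpa [Finset.mem_powersetCard, hammingNorm] using hs
  · intro x _
    funext i
    have : ∀ b : Fin 2, (if b ≠ 0 then 1 else 0) = b := by decide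
    simpa using this (x i)
  · intro s _
    ext i
    simp

theorem exists_perm_of_hammingNorm_eq {x y : Bits n} (h : hammingNorm x = hammingNorm y) :
    ∃ σ : Perm (Fin n), x = y ∘ σ := by
  have hcard : Fintype.card {i // x i ≠ 0} = Fintype.card {i // y i ≠ 0} := by
    rwa [Fintype.card_subtype, Fintype.card_subtype]
  let e := Fintype.equivOfCardEq hcard
  refine ⟨e.extendSubtype, funext fun i => ?_⟩
  have hb : ∀ a b : Fin 2, (a ≠ 0 ↔ b ≠ 0) → a = b := by decide
  refine hb _ _ ⟨fun hi => e.extendSubtype_mem i hi, fun hi => ?_⟩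
  by_contra hx
  exact e.extendSubtype_not_mem i (not_not.2 hx) hi

theorem guessProj_apply_eq {k : ℕ} {x y : Bits n} (h : hammingNorm x = hammingNorm y) :
    guessProj n k x x = guessProj n k y y := by
  obtain ⟨σ, rfl⟩ := exists_perm_of_hammingNorm_eq h
  have h1 : Commute (permOp σ) (guessProj n k) :=
    commute_guessProj (fun μ => commute_permOp_schurProjector μ σ) k
  have h2 := congrFun (congrFun h1.eq y) (y ∘ σ)
  rw [Matrix.mul_apply, Matrix.mul_apply, Finset.sum_eq_single (y ∘ ⇑σ),
    Finset.sum_eq_single y] at h2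
  · rw [permOp, Matrix.of_apply, if_pos (by funext i; simp), one_mul, mul_one] at h2
    exact h2
  · intro z _ hz
    rw [permOp, Matrix.of_apply, if_neg, mul_zero]
    rintro rfl
    exact hz (by funext i; simp)
  · simp
  · intro z _ hz
    rw [permOp, Matrix.of_apply, if_neg, zero_mul]
    rintro rfl
    exact hz (by funext i; simp)
  · simp

theorem choose_mul_guessProj_apply {k : ℕ} {x : Bits n} (hx : hammingNorm x = k) :
    (n.choose k : ℂ) * guessProj n k x x = (guessProj n k * weightProj n k).trace := by
  have h : ∀ y, (guessProj n k * weightProj n k) y y =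
      if hammingNorm y = k then guessProj n k x x else 0 := by
    intro y
    rw [weightProj, Matrix.mul_diagonal]
    split_ifs with hy
    · rw [mul_one, guessProj_apply_eq (hy.trans hx.symm)]
    · rw [mul_zero]
  rw [Matrix.trace]
  simp only [Matrix.diag_apply, h]
  rw [← Finset.sum_filter, Finset.sum_const,
    card_hammingNorm_eq, nsmul_eq_mul]

theorem guessProj_zero_apply {x : Bits n} (hx : hammingNorm x = 0) : guessProj n 0 x x = 1 := by
  have h1 : missProj n 0 *ᵥ ket x = 0 := by
    rw [missProj, Matrix.sum_mulVec]
    refine Finset.sum_eq_zero fun μ hμ => ?_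
    refine schurProjector_mulVec_eq_zero_of_hammingNorm_lt (k := 0) μ _ (fun y hy => ?_)
      (Nat.pos_of_ne_zero (Finset.mem_filter.1 hμ).2)
    by_contra hne
    refine hy (Pi.single_eq_of_ne ?_ _)
    rintro rfl
    exact hne hx
  have h2 := congrFun h1 x
  rw [ket, Matrix.mulVec_single_one, Matrix.col_apply, Pi.zero_apply] at h2
  have h3 := congrFun (congrFun (guessProj_add_missProj (n := n) 0) x) x
  rwa [Matrix.add_apply, h2, add_zero, Matrix.one_apply_eq] at h3

theorem guessProj_apply {x : Bits n} (hx : hammingNorm x ≤ n / 2) :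
    guessProj n (hammingNorm x) x x =
      1 - (hammingNorm x : ℂ) / ((n : ℂ) - hammingNorm x + 1) := by
  obtain ⟨k, hk⟩ : ∃ k, hammingNorm x = k := ⟨_, rfl⟩
  rw [hk] at hx ⊢
  cases k with
  | zero => rw [guessProj_zero_apply hk]; simp
  | succ m =>
    have h1 := choose_mul_guessProj_apply hk
    rw [trace_guessProj_mul_weightProj (by omega), trace_weightProj, trace_weightProj,
      card_hammingNorm_eq, card_hammingNorm_eq] at h1
    have h2 : (n.choose (m + 1) : ℂ) ≠ 0 := Nat.cast_ne_zero.2 (Nat.choose_pos (by omega)).ne'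
    -- The ratio `C(n,m) / C(n,m+1) = (m+1)/(n-m)` is the failure probability.
    have h3 : (n.choose (m + 1) : ℂ) * (m + 1) = n.choose m * ((n : ℂ) - m) := by
      have := Nat.choose_succ_right_eq n m
      rw [← Nat.cast_sub (by omega)]
      exact_mod_cast this
    have h4 : (n : ℂ) - m ≠ 0 := by
      rw [← Nat.cast_sub (by omega)]
      exact Nat.cast_ne_zero.2 (by omega)
    have h5 : (n : ℂ) - ((m + 1 : ℕ) : ℂ) + 1 = n - m := by push_cast; ring
    rw [h5, ← mul_right_inj' h2, h1]
    field_simp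
    push_cast
    linear_combination h3

/-- The success probability of the procedure. -/
theorem outputProb_scrambled (x : Bits n) (hx : hammingNorm x ≤ n / 2)
    (U : Matrix.unitaryGroup (Fin 2) ℂ) (σ : Perm (Fin n)) :
    (weakSchurSampling n).outputProb guess (scrambled x U σ) (hammingNorm x) =
      1 - (hammingNorm x : ℝ) / ((n : ℝ) - (hammingNorm x : ℝ) + 1) := by
  have h := congrArg Complex.re (guessProj_apply hx)
  rw [guessProj, Matrix.sum_apply, Complex.re_sum] at h
  rw [ProjectiveMeasurement.outputProb]
  simp only [outcomeProb_scrambled]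
  rw [h]
  rw [← Complex.ofReal_re (1 - (hammingNorm x : ℝ) / ((n : ℝ) - (hammingNorm x : ℝ) + 1))]
  push_cast
  rfl

end Guess

end

/-! ### The limit of the average success probability -/

noncomputable section

section Average

open Filter Topology

theorem sum_range_one_div_sub (n j : ℕ) (hj : j ≤ n + 1) :
    ∑ k ∈ Finset.range j, 1 / ((n : ℝ) - k + 1) =
      (harmonic (n + 1) : ℝ) - (harmonic (n + 1 - j) : ℝ) := by
  induction j with
  | zero => simp
  | succ j ih =>
    have h1 : n + 1 - j = (n + 1 - (j + 1)) + 1 := by omega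
    have h2 : ((n + 1 - (j + 1) : ℕ) : ℝ) + 1 = n - j + 1 := by
      rw [Nat.cast_sub hj]
      push_cast
      ring
    have h3 : (harmonic (n + 1 - j) : ℝ) =
        (harmonic (n + 1 - (j + 1)) : ℝ) + 1 / ((n : ℝ) - j + 1) := by
      rw [h1, harmonic_succ, Rat.cast_add, Rat.cast_inv, Rat.cast_natCast, Nat.cast_add_one, h2,
        one_div]
    rw [Finset.sum_range_succ, ih (by omega), h3]
    ring

/-- Since `k/(n-k+1) = (n+1)/(n-k+1) - 1`, the sum reduces to reciprocals of consecutive integers.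
-/
theorem average_eq (n : ℕ) :
    ∑ k ∈ Finset.range (n / 2 + 1), ((n / 2 + 1 : ℕ) : ℝ)⁻¹ * (1 - (k : ℝ) / ((n : ℝ) - k + 1)) =
      2 - ((n : ℝ) + 1) / ((n / 2 + 1 : ℕ) : ℝ) *
        ((harmonic (n + 1) : ℝ) - (harmonic (n - n / 2) : ℝ)) := by
  have h0 : ((n / 2 + 1 : ℕ) : ℝ) ≠ 0 := Nat.cast_ne_zero.2 (Nat.succ_ne_zero _)
  have h1 : ∀ k ∈ Finset.range (n / 2 + 1), (1 - (k : ℝ) / ((n : ℝ) - k + 1)) =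
      2 - ((n : ℝ) + 1) * (1 / ((n : ℝ) - k + 1)) := by
    intro k hk
    have hk' : k ≤ n := by
      have := Finset.mem_range.1 hk
      omega
    have h2 : (n : ℝ) - k + 1 ≠ 0 := by
      rw [← Nat.cast_sub hk']
      positivity
    field_simp
    ring
  have h3 := sum_range_one_div_sub n (n / 2 + 1) (by omega)
  rw [Nat.add_sub_add_right] at h3
  rw [← Finset.mul_sum, Finset.sum_congr rfl h1, Finset.sum_sub_distrib, ← Finset.mul_sum, h3,
    Finset.sum_const, Finset.card_range, nsmul_eq_mul]
  field_simp

/-- A common error bound for the two ratio limits below. -/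
theorem tendsto_two_div_half : Tendsto (fun n : ℕ => 2 / (((n / 2 : ℕ) : ℝ) + 1)) atTop (𝓝 0) := by
  have h := (tendsto_one_div_add_atTop_nhds_zero_nat (𝕜 := ℝ)).comp
    (Nat.tendsto_div_const_atTop (n := 2) two_ne_zero)
  simpa [Function.comp_def, div_eq_mul_inv] using h.const_mul 2

theorem cast_eq_two_mul_half (n : ℕ) : ∃ e : ℝ, 0 ≤ e ∧ e ≤ 1 ∧ (n : ℝ) = 2 * ((n / 2 : ℕ) : ℝ) + e :=
  ⟨((n % 2 : ℕ) : ℝ), Nat.cast_nonneg _, by exact_mod_cast (by omega : n % 2 ≤ 1),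
    by exact_mod_cast (Nat.div_add_mod n 2).symm⟩

theorem tendsto_succ_div_half :
    Tendsto (fun n : ℕ => ((n : ℝ) + 1) / ((n / 2 + 1 : ℕ) : ℝ)) atTop (𝓝 2) := by
  rw [tendsto_iff_norm_sub_tendsto_zero]
  refine squeeze_zero (fun _ => norm_nonneg _) (fun n => ?_) tendsto_two_div_half
  obtain ⟨e, h0, h1, he⟩ := cast_eq_two_mul_half n
  have hq : (0 : ℝ) < ((n / 2 : ℕ) : ℝ) + 1 := by positivity
  push_cast
  rw [he, Real.norm_eq_abs, div_sub' hq.ne', abs_div, abs_of_pos hq]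
  gcongr
  rw [abs_le]
  constructor <;> linarith

theorem tendsto_succ_div_sub_half :
    Tendsto (fun n : ℕ => ((n : ℝ) + 1) / ((n - n / 2 : ℕ) : ℝ)) atTop (𝓝 2) := by
  rw [tendsto_iff_norm_sub_tendsto_zero]
  refine squeeze_zero' (.of_forall fun _ => norm_nonneg _) ?_ tendsto_two_div_half
  filter_upwards [eventually_ge_atTop 2] with n hn
  obtain ⟨e, h0, h1, he⟩ := cast_eq_two_mul_half n
  have hq : (1 : ℝ) ≤ ((n / 2 : ℕ) : ℝ) := by exact_mod_cast (by omega : 1 ≤ n / 2)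
  rw [Nat.cast_sub (Nat.div_le_self n 2)]
  have hpos : (0 : ℝ) < (n : ℝ) - ((n / 2 : ℕ) : ℝ) := by linarith
  have hpos' : (0 : ℝ) < ((n / 2 : ℕ) : ℝ) + 1 := by linarith
  rw [Real.norm_eq_abs, div_sub' hpos.ne', abs_div, abs_of_pos hpos, div_le_div_iff₀ hpos hpos',
    abs_of_nonneg (by linarith)]
  nlinarith

/-- Euler's constant cancels in the difference, leaving the logarithm of a ratio that tends to `2`.
-/
theorem tendsto_harmonic_sub_harmonic :
    Tendsto (fun n : ℕ => (harmonic (n + 1) : ℝ) - (harmonic (n - n / 2) : ℝ)) atTop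
      (𝓝 (Real.log 2)) := by
  have hhalf : Tendsto (fun n : ℕ => n - n / 2) atTop atTop := by
    refine tendsto_atTop_mono (fun n => ?_) (Nat.tendsto_div_const_atTop (n := 2) two_ne_zero)
    omega
  have h1 := Real.tendsto_harmonic_sub_log.comp (tendsto_add_atTop_nat 1)
  have h2 := Real.tendsto_harmonic_sub_log.comp hhalf
  have h3 := tendsto_succ_div_sub_half.log two_ne_zero
  have h4 := (h1.sub h2).add h3
  rw [sub_self, zero_add] at h4
  refine h4.congr' ?_
  filter_upwards [eventually_ge_atTop 2] with n hn
  have hpos : ((n - n / 2 : ℕ) : ℝ) ≠ 0 := Nat.cast_ne_zero.2 (by omega)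
  simp only [Function.comp_apply]
  rw [Real.log_div (by positivity) hpos]
  push_cast
  ring

theorem tendsto_average :
    Tendsto (fun n : ℕ => ∑ k ∈ Finset.range (n / 2 + 1), ((n / 2 + 1 : ℕ) : ℝ)⁻¹ *
      (1 - (k : ℝ) / ((n : ℝ) - k + 1))) atTop (𝓝 (2 * (1 - Real.log 2))) := by
  simp only [average_eq]
  have h := (tendsto_succ_div_half.mul tendsto_harmonic_sub_harmonic).const_sub 2
  convert h using 2
  ring

/-- The expectation of a function of a statistic that is uniform on a finite set. -/
theorem sum_toReal_mul_of_map_eq_uniform {α : Type} [Fintype α] (p : PMF α) (w : α → ℕ)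
    (s : Finset ℕ) (hs : s.Nonempty) (hp : p.map w = PMF.uniformOfFinset s hs) (F : α → ℝ)
    (f : ℕ → ℝ) (hF : ∀ x, w x ∈ s → F x = f (w x)) :
    ∑ x, (p x).toReal * F x = ∑ k ∈ s, (s.card : ℝ)⁻¹ * f k := by
  classical
  have hmap : ∀ k, ∑ x, (if k = w x then p x else 0) = if k ∈ s then (s.card : ENNReal)⁻¹ else 0 := by
    intro k
    have h := PMF.uniformOfFinset_apply hs k
    rw [← hp, PMF.map_apply, tsum_fintype] at h
    convert h
  -- Points with `w x ∉ s`, where `F` is unconstrained, carry no mass.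
  have hzero : ∀ x, w x ∉ s → p x = 0 := by
    intro x hx
    have h := hmap (w x)
    rw [if_neg hx, Finset.sum_eq_zero_iff] at h
    simpa using h x (Finset.mem_univ x)
  have hreal : ∀ k ∈ s, ∑ x, (if k = w x then (p x).toReal else 0) = (s.card : ℝ)⁻¹ := by
    intro k hk
    have h := congrArg ENNReal.toReal (hmap k)
    rw [if_pos hk, ENNReal.toReal_sum (fun x _ => by split_ifs <;> simp [p.apply_ne_top])] at h
    simpa [apply_ite ENNReal.toReal] using h
  calc ∑ x, (p x).toReal * F x
      = ∑ x, ∑ k ∈ s, (if k = w x then (p x).toReal else 0) * f k := by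
        refine Finset.sum_congr rfl fun x _ => ?_
        by_cases hx : w x ∈ s
        · rw [Finset.sum_eq_single_of_mem (w x) hx (fun k _ hk => by rw [if_neg hk, zero_mul]),
            if_pos rfl, hF x hx]
        · simp [hzero x hx]
    _ = ∑ k ∈ s, (s.card : ℝ)⁻¹ * f k := by
        rw [Finset.sum_comm]
        refine Finset.sum_congr rfl fun k hk => ?_
        rw [← Finset.sum_mul, hreal k hk]

end Average

end

theorem theorem1 :
    ∃ M : ∀ n : ℕ, ProjectiveMeasurement n (Shape n),
      (∀ n, IsWeakSchurSampling (M n)) ∧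
      (∀ (n : ℕ) (x : Bits n), hammingNorm x ≤ n / 2 →
        ∀ (U : Matrix.unitaryGroup (Fin 2) ℂ) (σ : Equiv.Perm (Fin n)),
          (M n).outputProb guess (scrambled x U σ) (hammingNorm x) =
            1 - (hammingNorm x : ℝ) / ((n : ℝ) - (hammingNorm x : ℝ) + 1)) ∧
      (∀ (p : ∀ n : ℕ, PMF (Bits n))
        (U : ∀ n : ℕ, Bits n → Matrix.unitaryGroup (Fin 2) ℂ)
        (σ : ∀ n : ℕ, Bits n → Equiv.Perm (Fin n)),
        (∀ n, (p n).map (fun x => hammingNorm x) =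
          PMF.uniformOfFinset (Finset.range (n / 2 + 1)) Finset.nonempty_range_add_one) →
        Filter.Tendsto
          (fun n => ∑ x : Bits n, (p n x).toReal *
            (M n).outputProb guess (scrambled x (U n x) (σ n x)) (hammingNorm x))
          Filter.atTop (nhds (2 * (1 - Real.log 2)))) ∧
      |2 * (1 - Real.log 2) - 0.614| < 0.0005 := by
  refine ⟨weakSchurSampling, fun n μ => rfl, fun n x hx U σ => outputProb_scrambled x hx U σ,
    fun p U σ hp => tendsto_average.congr fun n => ?_, ?_⟩
  · rw [sum_toReal_mul_of_map_eq_uniform (p n) _ _ _ (hp n) _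
      (fun k => 1 - (k : ℝ) / ((n : ℝ) - k + 1))
      (fun x hx => outputProb_scrambled x (Nat.lt_succ_iff.1 (Finset.mem_range.1 hx)) _ _),
      Finset.card_range]
  · have h1 := Real.log_two_gt_d9
    have h2 := Real.log_two_lt_d9
    rw [abs_lt]
    constructor <;> norm_num at * <;> linarith
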